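/- For real $r$ let $\omega(r)$ be the exponent of multiplying an $n^{r}\times n$ matrix by an $n\times n$ matrix: the infimum of all real $\sigma$ such that for every $n\ge 1$ the product of a $\lceil n^{r}\rceil\times n$ by an $n\times n$ matrix can be computed with $O(n^{\sigma})$ algebraic operations (straight-line programs over the integers with operations $+,-,\times$ and integer constants). For $r\le 0$ the first matrix has a single row. The min-plus product is $(A\star B)_{ij}=\min_k(A_{ik}+B_{kj})$, and $C'$ is a $\delta$-approximation to $C$ if $C_{ij}\le C'_{ij}\le\delta\, C_{ij}$ for all $i,j$. In the Congested Clique on $n$ vertices, in each synchronous round every vertex sends a message of $\lceil\log_2 n\rceil$ bits to every other vertex; local computation is free. **Theorem.** Fix $0<r\le 1$. The equation $$r'=1-(1-r)\,\omega(r')$$ has exactly one real solution $r'$. Let $n\ge 0$ and $M\ge 1$ be integers and $R\ge 1$ a real number. Let $A$ be an $n^{r}\times n$ matrix (any number of rows up to $\lceil n^r\rceil$) and $B$ an $n\times n$ matrix, both with entries in $\{1,\dots,M\}$. Each of the $n$ vertices holds one row of $B$, different vertices hold different rows, and distinct rows of $A$ are held by distinct vertices; a vertex initially knows only the rows it holds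 and their indices. 1. If the exponent $\omega(r')$ is attained, i.e. $O(q^{\omega(r')})$ algebraic operations suffice to multiply a $\lceil q^{r'}\rceil\times q$ matrix by a $q\times q$ matrix, then there is a deterministic Congested Clique algorithm that computes a $(1+1/R)$-approximation to $A\star B$ in $$O\bigl(R\cdot n^{1-2/\omega(r')}\cdot\log M\bigr)$$ rounds. 2. Without this assumption, for every $\varepsilon>0$ there is such an algorithm with $O\bigl(R\cdot n^{1-2/\omega(r')+\varepsilon}\cdot\log M\bigr)$ rounds. The implied constants do not depend on $n,M,R,A,B$ or on which vertex holds which row. The algorithm may depend on $n$, $M$, $R$ and the number of rows of $A$, but not on the matrices or on the assignment of their rows to vertices. At the end, the vertex that held a row of $A$ knows the corresponding row of the output. -/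

import Mathlib

/-! ### Min-plus product and approximation -/

/-- The distance (min-plus) product `(A ⋆ B) i j = min_k (A i k + B k j)`. -/
noncomputable def minPlus {s n q : ℕ} (A : Matrix (Fin s) (Fin n) ℕ) (B : Matrix (Fin n) (Fin q) ℕ) :
    Matrix (Fin s) (Fin q) ℕ :=
  fun i j => ⨅ k : Fin n, (A i k + B k j)

/-- `C'` is a `δ`-approximation to `C`: entrywise `C ≤ C' ≤ δ · C`. -/
def IsApproximation {s q : ℕ} (δ : ℝ) (C C' : Matrix (Fin s) (Fin q) ℕ) : Prop :=
  ∀ i j, (C i j : ℝ) ≤ C' i j ∧ (C' i j : ℝ) ≤ δ * C i j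

/-! ### Algebraic complexity of rectangular matrix multiplication -/

/-- The ring operations. -/
inductive RingOp where
  | add
  | sub
  | mul

/-- An operand of an instruction: an integer constant, an input variable, or the result of the
`j`-th earlier instruction. -/
inductive Operand (ι : Type) where
  | const (c : ℤ)
  | var (i : ι)
  | reg (j : ℕ)

/-- One algebraic operation. -/
structure Instr (ι : Type) where
  op : RingOp
  left : Operand ι
  right : Operand ι

/-- A straight-line program with input variables `ι` and outputs `κ`. -/
structure AlgProgram (ι κ : Type) where
  code : List (Instr ι)
  out : κ → Operand ι

/-- The value of a ring operation. -/
def RingOp.eval {K : Type*} [CommRing K] : RingOp → K → K → K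
  | .add, a, b => a + b
  | .sub, a, b => a - b
  | .mul, a, b => a * b

/-- The value of an operand, given the inputs `x` and the results `regs` computed so far
(a reference to a result that is not there yet reads `0`). -/
def Operand.eval {ι : Type} {K : Type*} [CommRing K] (x : ι → K) (regs : List K) : Operand ι → K
  | .const c => (c : K)
  | .var i => x i
  | .reg j => regs.getD j 0

/-- The value of one instruction. -/
def Instr.eval {ι : Type} {K : Type*} [CommRing K] (x : ι → K) (regs : List K) (a : Instr ι) : K :=
  a.op.eval (a.left.eval x regs) (a.right.eval x regs)

/-- The results of all instructions, in the order in which they are executed. -/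
def AlgProgram.results {ι κ : Type} {K : Type*} [CommRing K] (P : AlgProgram ι κ) (x : ι → K) :
    List K :=
  P.code.foldl (fun regs a => regs ++ [a.eval x regs]) []

/-- The outputs of the program on the inputs `x`. -/
def AlgProgram.eval {ι κ : Type} {K : Type*} [CommRing K] (P : AlgProgram ι κ) (x : ι → K) :
    κ → K :=
  fun o => (P.out o).eval x (P.results x)

/-- The number of algebraic operations performed by the program. -/
def AlgProgram.ops {ι κ : Type} (P : AlgProgram ι κ) : ℕ := P.code.length

/-- The program multiplies every integer `s × n` matrix by every integer `n × n` matrix. -/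
def AlgProgram.Multiplies {s n : ℕ}
    (P : AlgProgram ((Fin s × Fin n) ⊕ (Fin n × Fin n)) (Fin s × Fin n)) : Prop :=
  ∀ (S : Matrix (Fin s) (Fin n) ℤ) (T : Matrix (Fin n) (Fin n) ℤ) (i : Fin s) (j : Fin n),
    P.eval (Sum.elim (fun p => S p.1 p.2) (fun p => T p.1 p.2)) (i, j) = (S * T) i j

/-- `O(n ^ σ)` algebraic operations suffice to multiply a `⌈n ^ r⌉ × n` matrix by an `n × n`
matrix. For `r ≤ 0` and `n ≥ 1` the first matrix has a single row. -/
def HasMMExponent (r σ : ℝ) : Prop :=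
  ∃ C : ℝ, ∀ n : ℕ, 1 ≤ n →
    ∃ P : AlgProgram ((Fin ⌈(n : ℝ) ^ r⌉₊ × Fin n) ⊕ (Fin n × Fin n))
        (Fin ⌈(n : ℝ) ^ r⌉₊ × Fin n),
      P.Multiplies ∧ (P.ops : ℝ) ≤ C * (n : ℝ) ^ σ

/-- The exponent `ω(r)` of the multiplication of an `n ^ r × n` matrix by an `n × n` matrix. -/
noncomputable def mmExponent (r : ℝ) : ℝ := sInf {σ : ℝ | HasMMExponent r σ}

/-! ### The Congested Clique -/

/-- A message on `n` vertices: `⌈log₂ n⌉` bits. -/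
abbrev Message (n : ℕ) : Type := Fin (Nat.clog 2 n) → Bool

/-- A deterministic algorithm in the Congested Clique on the vertices `Fin n`, with local inputs in
`I` and local outputs in `O`; local computation is free, as usual. In every round each vertex sends
one message to each vertex (`send v st w` is the message from `v` to `w`) and then updates its state
from its old state and the messages received (`step v st msg`, where `msg w` came from `w`). -/
structure CCAlgorithm (n : ℕ) (I O : Type) where
  State : Type
  init : Fin n → I → State
  send : Fin n → State → Fin n → Message n
  step : Fin n → State → (Fin n → Message n) → State
  output : Fin n → State → O

/-- The states of all vertices after `t` rounds. -/
def CCAlgorithm.states {n : ℕ} {I O : Type} (alg : CCAlgorithm n I O) (inp : Fin n → I) :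
    ℕ → Fin n → alg.State
  | 0 => fun v => alg.init v (inp v)
  | t + 1 => fun v =>
      alg.step v (alg.states inp t v) (fun w => alg.send w (alg.states inp t w) v)

/-- The outputs of all vertices when the algorithm is stopped after `t` rounds. -/
def CCAlgorithm.outputs {n : ℕ} {I O : Type} (alg : CCAlgorithm n I O) (inp : Fin n → I) (t : ℕ) :
    Fin n → O :=
  fun v => alg.output v (alg.states inp t v)

/-- What the vertex `v` knows of a matrix `X` whose row `i` is held by the vertex `holder i`:
the rows that `v` holds, and their indices. -/
def heldRows {p n : ℕ} (holder : Fin p → Fin n) (X : Matrix (Fin p) (Fin n) ℕ) (v : Fin n) :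
    Fin p → Option (Fin n → ℕ) :=
  fun i => if holder i = v then some (X i) else none

/-- The local input of a vertex: what it holds of the `s × n` matrix `A` and of the `n × n`
matrix `B`. -/
abbrev LocalInput (s n : ℕ) : Type :=
  (Fin s → Option (Fin n → ℕ)) × (Fin n → Option (Fin n → ℕ))

/-- In the Congested Clique on `n` vertices, a `(1 + 1/R)`-approximation to the min-plus product of
an `n ^ r × n` matrix (any number of rows up to `⌈n ^ r⌉`) by an `n × n` matrix, with entries in
`{1, …, M}`, is computed deterministically in `O(R · n ^ e · log M)` rounds, where the implied
constant depends on `r` and `e` only. Each vertex holds one row of `B`, and at most one row of `A`.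
The assignment of the rows is arbitrary and is not known in advance. The vertex that holds a row
of `A` outputs the same row of the result. -/
def ApproxMinPlusInRounds (r e : ℝ) : Prop :=
  ∃ C : ℝ, ∀ (n s M : ℕ) (R : ℝ), s ≤ ⌈(n : ℝ) ^ r⌉₊ → 1 ≤ M → 1 ≤ R →
    ∃ (alg : CCAlgorithm n (LocalInput s n) (Fin n → ℕ)) (T : ℕ),
      (T : ℝ) ≤ C * (R * (n : ℝ) ^ e * Real.log M) ∧
      ∀ (holderA : Fin s ↪ Fin n) (holderB : Fin n ≃ Fin n)
        (A : Matrix (Fin s) (Fin n) ℕ) (B : Matrix (Fin n) (Fin n) ℕ),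
        (∀ i k, 1 ≤ A i k ∧ A i k ≤ M) → (∀ k j, 1 ≤ B k j ∧ B k j ≤ M) →
        IsApproximation (1 + 1 / R) (minPlus A B)
          (fun i => alg.outputs (fun v => (heldRows holderA A v, heldRows holderB B v)) T
            (holderA i))

/-! The min-plus product is reduced to one product over a finite commutative ring, and that product
is distributed over the vertices by means of a bilinear algorithm for small rectangular matrices.

Reduction (Zwick). At scale `i` an entry `a ≤ 2 ^ i` becomes the monomial with exponent `⌈a * D / 2
^ i⌉`, so a coefficient of the ring product counts the indices `k` with a given rounded sum. At the
scale just above the true value `c`, rounding costs at most `4 * c / D ≤ c / R`. All scales together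
form one ring, whose elements fit into `O(R log M)` messages when `M ≥ 2`
(`isApproximation_decodeEntry`, `card_scaleRing`).

Bilinear algorithms. Running a straight-line program over iterated dual numbers and reading off the
mixed coefficient turns `k` operations into at most `2 * k` products of a function of `S` and a
function of `T` (`AlgProgram.Multiplies.exists_isBilinearAlgorithm`). Counting over `ZMod 2` then
gives `2 ≤ ω`.

Distribution (`Learns.matrix_mul`). Cut the matrices into a `g × g` array of `p × q` and `q × q`
blocks. Owners of blocks evaluate the factors of all products `t`; the owner of `t` multiplies the
two resulting `g × g` matrices; the entries return to the block owners, which recombine them. With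
`q ≈ n ^ (1/σ)` and `p ≈ q ^ r'` there are `O(n)` products, and `g ≈ n ^ (1 - 1/σ)` covers all rows
of `A` exactly because `1 - r' ≤ (1 - r) * σ`. A vertex then handles `O(g ^ 2 + n)` ring elements,
which `Learns.route` delivers in `O(n ^ (1 - 2/σ))` rounds per message of an element.

The balance equation has one solution since `x + (1 - r) * ω(x)` is continuous and strictly
increasing.

Protocols are composed through `Learns`: local computation being free, only what a state determines
matters. -/

/-! ### Knowledge in the Congested Clique -/

/-- After `T` rounds of some algorithm, the state of `v` determines the input configuration in `Ω`
up to the relation `ρ v`. -/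
def Learns {n : ℕ} {I Ω : Type} (inp : Ω → Fin n → I) (T : ℕ)
    (ρ : Fin n → Ω → Ω → Prop) : Prop :=
  ∃ alg : CCAlgorithm n I Unit, ∀ v ω ω',
    alg.states (inp ω) T v = alg.states (inp ω') T v → ρ v ω ω'

section Learns

variable {n : ℕ} {I Ω : Type} {inp : Ω → Fin n → I} {T : ℕ} {ρ : Fin n → Ω → Ω → Prop}

theorem Learns.mono (h : Learns inp T ρ) {ρ' : Fin n → Ω → Ω → Prop}
    (hρ : ∀ v ω ω', ρ v ω ω' → ρ' v ω ω') : Learns inp T ρ' := by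
  obtain ⟨alg, halg⟩ := h
  exact ⟨alg, fun v ω ω' e => hρ _ _ _ (halg v ω ω' e)⟩

theorem learns_input (inp : Ω → Fin n → I) : Learns inp 0 (fun v ω ω' => inp ω v = inp ω' v) :=
  ⟨⟨I, fun _ i => i, fun _ _ _ _ => false, fun _ st _ => st, fun _ _ => ()⟩,
    fun _ _ _ h => h⟩

/-- What is determined by the knowledge of the vertices can be output. -/
theorem Learns.exists_outputs {O : Type} [Inhabited O] (h : Learns inp T ρ) (out : Ω → Fin n → O)
    (hout : ∀ v ω ω', ρ v ω ω' → out ω v = out ω' v) :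
    ∃ alg : CCAlgorithm n I O, ∀ ω, alg.outputs (inp ω) T = out ω := by
  classical
  obtain ⟨alg, halg⟩ := h
  let alg' : CCAlgorithm n I O :=
    { State := alg.State
      init := alg.init
      send := alg.send
      step := alg.step
      output := fun v st =>
        if h : ∃ ω, alg.states (inp ω) T v = st then out h.choose v else default }
  have hst : ∀ ω t, alg'.states (inp ω) t = alg.states (inp ω) t := by
    intro ω t
    induction t with
    | zero => rfl
    | succ t ih => simp only [CCAlgorithm.states, ih]; rfl
  refine ⟨alg', fun ω => funext fun v => ?_⟩
  have h : ∃ ω', alg.states (inp ω') T v = alg.states (inp ω) T v := ⟨ω, rfl⟩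
  change alg'.output v (alg'.states (inp ω) T v) = _
  rw [hst]
  change (if h : ∃ ω', alg.states (inp ω') T v = alg.states (inp ω) T v
    then out h.choose v else default) = _
  rw [dif_pos h]
  exact hout _ _ _ (halg _ _ _ h.choose_spec)

/-- One round of communication. -/
theorem Learns.exchange_message (h : Learns inp T ρ) (m : Ω → Fin n → Fin n → Message n)
    (hm : ∀ v ω ω', ρ v ω ω' → m ω v = m ω' v) :
    Learns inp (T + 1) (fun v ω ω' => ρ v ω ω' ∧ ∀ u, m ω u v = m ω' u v) := by
  classical
  obtain ⟨alg, halg⟩ := h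
  let alg' : CCAlgorithm n I Unit :=
    { State := (ℕ × alg.State) ⊕ (alg.State × (Fin n → Message n))
      init := fun v i => Sum.inl (0, alg.init v i)
      send := fun v st => match st with
        | Sum.inl (t, s) => if t < T then alg.send v s else
            -- Any configuration consistent with the state will do: by `hm` the message is the same
            -- for all of them.
            if h : ∃ ω, alg.states (inp ω) T v = s then m h.choose v else fun _ _ => false
        | Sum.inr _ => fun _ _ => false
      step := fun v st msg => match st with
        | Sum.inl (t, s) => if t < T then Sum.inl (t + 1, alg.step v s msg) else Sum.inr (s, msg)
        | Sum.inr s => Sum.inr s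
      output := fun _ _ => () }
  have hst : ∀ ω t, t ≤ T → ∀ v, alg'.states (inp ω) t v = Sum.inl (t, alg.states (inp ω) t v) := by
    intro ω t
    induction t with
    | zero => intro _ v; rfl
    | succ t ih =>
      intro ht v
      have ih := ih (by omega)
      have hlt : t < T := by omega
      simp only [CCAlgorithm.states, ih]
      simp [alg', hlt]
  have hlast : ∀ ω v, alg'.states (inp ω) (T + 1) v =
      Sum.inr (alg.states (inp ω) T v, fun u => m ω u v) := by
    intro ω v
    simp only [CCAlgorithm.states, hst ω T le_rfl]
    simp only [alg', lt_irrefl, if_false, Sum.inr.injEq, Prod.mk.injEq, true_and]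
    funext u
    have h : ∃ ω', alg.states (inp ω') T u = alg.states (inp ω) T u := ⟨ω, rfl⟩
    rw [dif_pos h]
    exact congrFun (hm _ _ _ (halg _ _ _ h.choose_spec)) v
  refine ⟨alg', fun v ω ω' e => ?_⟩
  rw [hlast, hlast] at e
  have e := Prod.mk.inj (Sum.inr.inj e)
  exact ⟨halg _ _ _ e.1, fun u => congrFun e.2 u⟩

/-- `L` rounds of communication. -/
theorem Learns.exchange_messages (h : Learns inp T ρ) {L : ℕ}
    (m : Ω → Fin n → Fin n → Fin L → Message n)
    (hm : ∀ v ω ω', ρ v ω ω' → m ω v = m ω' v) :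
    Learns inp (T + L) (fun v ω ω' => ρ v ω ω' ∧ ∀ u, m ω u v = m ω' u v) := by
  induction L with
  | zero => exact h.mono fun v ω ω' hρ => ⟨hρ, fun u => funext fun i => i.elim0⟩
  | succ L ih =>
    have h1 := ih (fun ω u v i => m ω u v i.castSucc)
      (fun v ω ω' hρ => by rw [hm v ω ω' hρ])
    have h2 := h1.exchange_message (fun ω u v => m ω u v (Fin.last L))
      (fun v ω ω' hρ => by rw [hm v ω ω' hρ.1])
    refine h2.mono ?_
    rintro v ω ω' ⟨⟨h0, h3⟩, h4⟩
    refine ⟨h0, fun u => funext fun i => ?_⟩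
    refine Fin.lastCases (h4 u) (fun j => ?_) i
    exact congrFun (h3 u) j

/-- `L` rounds of communication with messages in a finite type. -/
theorem Learns.exchange (h : Learns inp T ρ) {W : Type} [Fintype W] {L : ℕ}
    (hW : Fintype.card W ≤ 2 ^ (Nat.clog 2 n * L))
    (m : Ω → Fin n → Fin n → W) (hm : ∀ v ω ω', ρ v ω ω' → m ω v = m ω' v) :
    Learns inp (T + L) (fun v ω ω' => ρ v ω ω' ∧ ∀ u, m ω u v = m ω' u v) := by
  have hc : Fintype.card W ≤ Fintype.card (Fin L → Message n) := by
    simpa [pow_mul] using hW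
  obtain ⟨f⟩ := Function.Embedding.nonempty_of_card_le hc
  refine (h.exchange_messages (fun ω u v => f (m ω u v))
    (fun v ω ω' hρ => by rw [hm v ω ω' hρ])).mono ?_
  rintro v ω ω' ⟨h0, h1⟩
  exact ⟨h0, fun u => f.injective (h1 u)⟩

/-- Messages `e : E` from `src e` to `dst e`, at most one for each pair of vertices and each slot in
`Fin K`, are sent directly. -/
theorem Learns.direct (h : Learns inp T ρ) {W : Type} [Fintype W] [Inhabited W] {L K : ℕ}
    (hW : Fintype.card W ≤ 2 ^ (Nat.clog 2 n * L))
    {E : Type} (src dst : Ω → E → Fin n) (slot : Ω → E → Fin K)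
    (hpat : ∀ v ω ω', ρ v ω ω' → src ω = src ω' ∧ dst ω = dst ω' ∧ slot ω = slot ω')
    (hinj : ∀ ω e e', src ω e = src ω e' → dst ω e = dst ω e' → slot ω e = slot ω e' → e = e')
    (val : Ω → E → W)
    (hval : ∀ ω ω' e, ρ (src ω e) ω ω' → val ω e = val ω' e) :
    Learns inp (T + K * L)
      (fun v ω ω' => ρ v ω ω' ∧ ∀ e, dst ω e = v → val ω e = val ω' e) := by
  classical
  let m : Ω → Fin n → Fin n → Fin K → W := fun ω u v κ =>
    if h : ∃ e, src ω e = u ∧ dst ω e = v ∧ slot ω e = κ then val ω h.choose else default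
  have hmv : ∀ ω e, m ω (src ω e) (dst ω e) (slot ω e) = val ω e := by
    intro ω e
    have h : ∃ e', src ω e' = src ω e ∧ dst ω e' = dst ω e ∧ slot ω e' = slot ω e :=
      ⟨e, rfl, rfl, rfl⟩
    simp only [m, dif_pos h]
    obtain ⟨h1, h2, h3⟩ := h.choose_spec
    rw [hinj ω _ _ h1 h2 h3]
  have hcard : Fintype.card (Fin K → W) ≤ 2 ^ (Nat.clog 2 n * (K * L)) := by
    calc Fintype.card (Fin K → W) = Fintype.card W ^ K := by simp
      _ ≤ (2 ^ (Nat.clog 2 n * L)) ^ K := Nat.pow_le_pow_left hW K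
      _ = _ := by rw [← pow_mul]; congr 1; ring
  refine (h.exchange hcard m ?_).mono ?_
  · intro v ω ω' hρ
    obtain ⟨h1, h2, h3⟩ := hpat v ω ω' hρ
    funext w κ
    simp only [m, h1, h2, h3]
    split_ifs with hex
    · refine hval _ _ _ ?_
      have hsv : src ω hex.choose = v := (congrFun h1 _).trans hex.choose_spec.1
      rwa [hsv]
    · rfl
  · rintro v ω ω' ⟨hρ, h0⟩
    refine ⟨hρ, ?_⟩
    rintro e rfl
    obtain ⟨h1, h2, h3⟩ := hpat _ ω ω' hρ
    have := congrFun (h0 (src ω e)) (slot ω e)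
    rw [hmv] at this
    rw [this, h1, h2, h3, hmv]

end Learns

/-! ### Routing by edge colouring -/

/-- Greedy edge colouring of a bipartite multigraph of maximum degree `Δ` with `2 * Δ` colours. -/
theorem exists_edge_colouring {E V γ : Type} [Fintype E] [DecidableEq V] [Fintype γ]
    (src dst : E → V) (Δ : ℕ)
    (hsrc : ∀ v, (Finset.univ.filter fun e => src e = v).card ≤ Δ)
    (hdst : ∀ v, (Finset.univ.filter fun e => dst e = v).card ≤ Δ)
    (hγ : 2 * Δ ≤ Fintype.card γ) :
    ∃ c : E → γ, ∀ e e', (src e = src e' ∨ dst e = dst e') → c e = c e' → e = e' := by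
  classical
  cases isEmpty_or_nonempty E with
  | inl h => exact ⟨isEmptyElim, fun e => isEmptyElim e⟩
  | inr h =>
    obtain ⟨e₁⟩ := h
    have hΔ : 1 ≤ Δ := le_trans (Finset.card_pos.mpr ⟨e₁, by simp⟩) (hsrc (src e₁))
    have hne : Nonempty γ := Fintype.card_pos_iff.mp (by omega)
    suffices H : ∀ t : Finset E, ∃ c : E → γ, ∀ e ∈ t, ∀ e' ∈ t,
        (src e = src e' ∨ dst e = dst e') → c e = c e' → e = e' by
      obtain ⟨c, hc⟩ := H Finset.univ
      exact ⟨c, fun e e' => hc e (Finset.mem_univ _) e' (Finset.mem_univ _)⟩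
    intro t
    induction t using Finset.induction_on with
    | empty => exact ⟨fun _ => hne.some, by simp⟩
    | insert e₀ t he₀ ih =>
      obtain ⟨c, hc⟩ := ih
      -- The edge `e₀` itself counts towards the degree but not towards `t`, so each endpoint
      -- forbids fewer than `Δ` colours.
      have hlt : ∀ f : E → V, (∀ v, (Finset.univ.filter fun e => f e = v).card ≤ Δ) →
          (t.filter fun e => f e = f e₀).card < Δ := by
        intro f hf
        refine lt_of_lt_of_le (Finset.card_lt_card ?_) (hf (f e₀))
        refine ⟨fun e he => by simp at he ⊢; exact he.2, fun hsub => ?_⟩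
        have := hsub (show e₀ ∈ _ by simp)
        exact he₀ (Finset.mem_filter.mp this).1
      let bad : Finset γ := ((t.filter fun e => src e = src e₀).image c) ∪
        ((t.filter fun e => dst e = dst e₀).image c)
      have hbad : bad.card < Fintype.card γ := by
        have h1 := Finset.card_union_le ((t.filter fun e => src e = src e₀).image c)
          ((t.filter fun e => dst e = dst e₀).image c)
        have h2 := Finset.card_image_le (s := t.filter fun e => src e = src e₀) (f := c)
        have h3 := Finset.card_image_le (s := t.filter fun e => dst e = dst e₀) (f := c)
        have h4 := hlt src hsrc
        have h5 := hlt dst hdst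
        change Finset.card (_ ∪ _) < _
        omega
      obtain ⟨x, hx⟩ : ∃ x, x ∉ bad := by
        by_contra! hall
        have : bad = Finset.univ := Finset.eq_univ_iff_forall.mpr hall
        rw [this, Finset.card_univ] at hbad
        exact lt_irrefl _ hbad
      have hxt : ∀ e ∈ t, (src e = src e₀ ∨ dst e = dst e₀) → c e ≠ x := by
        rintro e he hor rfl
        apply hx
        rcases hor with h | h
        · exact Finset.mem_union_left _ (Finset.mem_image_of_mem _ (by simp [he, h]))
        · exact Finset.mem_union_right _ (Finset.mem_image_of_mem _ (by simp [he, h]))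
      have hupd : ∀ e ∈ t, Function.update c e₀ x e = c e := fun e he =>
        Function.update_of_ne (ne_of_mem_of_not_mem he he₀) _ _
      refine ⟨Function.update c e₀ x, ?_⟩
      intro e he e' he' hor heq
      rcases Finset.mem_insert.mp he with h1 | h1 <;>
        rcases Finset.mem_insert.mp he' with h2 | h2
      · rw [h1, h2]
      · subst h1
        rw [Function.update_self, hupd _ h2] at heq
        exact absurd heq.symm (hxt e' h2 (hor.imp Eq.symm Eq.symm))
      · subst h2
        rw [Function.update_self, hupd _ h1] at heq
        exact absurd heq (hxt e h1 hor)
      · rw [hupd _ h1, hupd _ h2] at heq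
        exact hc e h1 e' h2 hor heq

/-- Routing of messages along a pattern known to all vertices: if each vertex sends and receives at
most `n * K` words of `L` messages, then `4 * K * L` rounds suffice. -/
theorem Learns.route {n : ℕ} {I Ω : Type} {inp : Ω → Fin n → I} {T : ℕ}
    {ρ : Fin n → Ω → Ω → Prop} (h : Learns inp T ρ)
    {W : Type} [Fintype W] [Inhabited W] {L K : ℕ}
    (hW : Fintype.card W ≤ 2 ^ (Nat.clog 2 n * L))
    {E : Type} [Fintype E] (src dst : Ω → E → Fin n)
    (hpat : ∀ v ω ω', ρ v ω ω' → src ω = src ω' ∧ dst ω = dst ω')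
    (hsrc : ∀ ω v, (Finset.univ.filter fun e => src ω e = v).card ≤ n * K)
    (hdst : ∀ ω v, (Finset.univ.filter fun e => dst ω e = v).card ≤ n * K)
    (val : Ω → E → W)
    (hval : ∀ ω ω' e, ρ (src ω e) ω ω' → val ω e = val ω' e) :
    Learns inp (T + 4 * K * L)
      (fun v ω ω' => ρ v ω ω' ∧ ∀ e, dst ω e = v → val ω e = val ω' e) := by
  classical
  -- A colour is a relay vertex together with one of `2 * K` slots. It is chosen as a function of
  -- the pattern alone, so vertices that know the pattern agree on the colouring.
  have hcol : ∀ p : {p : (E → Fin n) × (E → Fin n) //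
      (∀ v, (Finset.univ.filter fun e => p.1 e = v).card ≤ n * K) ∧
      (∀ v, (Finset.univ.filter fun e => p.2 e = v).card ≤ n * K)},
      ∃ c : E → Fin n × Fin (2 * K),
        ∀ e e', (p.1.1 e = p.1.1 e' ∨ p.1.2 e = p.1.2 e') → c e = c e' → e = e' := by
    intro p
    exact exists_edge_colouring p.1.1 p.1.2 (n * K) p.2.1 p.2.2
      (by simp only [Fintype.card_prod, Fintype.card_fin]; exact le_of_eq (by ring))
  choose F hF using hcol
  let c : Ω → E → Fin n × Fin (2 * K) := fun ω => F ⟨(src ω, dst ω), hsrc ω, hdst ω⟩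
  have hc : ∀ ω e e', (src ω e = src ω e' ∨ dst ω e = dst ω e') → c ω e = c ω e' → e = e' :=
    fun ω => hF ⟨(src ω, dst ω), hsrc ω, hdst ω⟩
  have hceq : ∀ ω ω', src ω = src ω' → dst ω = dst ω' → c ω = c ω' := by
    intro ω ω' h1 h2
    simp only [c, h1, h2]
  -- The first leg is free of conflicts since edges with a common source differ in colour, the
  -- second since edges with a common target do.
  have h1 := h.direct (K := 2 * K) hW src (fun ω e => (c ω e).1) (fun ω e => (c ω e).2)
    (fun v ω ω' hρ => by
      obtain ⟨h1, h2⟩ := hpat v ω ω' hρ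
      rw [hceq ω ω' h1 h2]
      exact ⟨h1, rfl, rfl⟩)
    (fun ω e e' h1 h2 h3 => hc ω e e' (Or.inl h1) (Prod.ext h2 h3)) val hval
  have h2 := h1.direct (K := 2 * K) hW (fun ω e => (c ω e).1) dst (fun ω e => (c ω e).2)
    (fun v ω ω' hρ => by
      obtain ⟨h1, h2⟩ := hpat v ω ω' hρ.1
      rw [hceq ω ω' h1 h2]
      exact ⟨rfl, h2, rfl⟩)
    (fun ω e e' h1 h2 h3 => hc ω e e' (Or.inr h2) (Prod.ext h1 h3)) val
    (fun ω ω' e hρ => hρ.2 e rfl)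
  have hT : T + 2 * K * L + 2 * K * L = T + 4 * K * L := by ring
  rw [hT] at h2
  exact h2.mono fun v ω ω' hρ => ⟨hρ.1.1, hρ.2⟩

/-! ### Straight-line programs -/

/-- The results of all instructions of `code` on the inputs `x`. -/
def runCode {ι : Type} {K : Type*} [CommRing K] (x : ι → K) (code : List (Instr ι)) : List K :=
  code.foldl (fun regs a => regs ++ [a.eval x regs]) []

section runCode

variable {ι κ : Type} {K L : Type*} [CommRing K] [CommRing L]

@[simp] theorem runCode_nil (x : ι → K) : runCode x [] = [] := rfl

theorem runCode_concat (x : ι → K) (code : List (Instr ι)) (a : Instr ι) :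
    runCode x (code ++ [a]) = runCode x code ++ [a.eval x (runCode x code)] := by
  simp [runCode]

@[simp] theorem length_runCode (x : ι → K) (code : List (Instr ι)) :
    (runCode x code).length = code.length := by
  induction code using List.reverseRecOn with
  | nil => rfl
  | append_singleton l a ih => simp [runCode_concat, ih]

theorem Operand.eval_map (f : K →+* L) (x : ι → K) (regs : List K) (o : Operand ι) :
    o.eval (fun i => f (x i)) (regs.map f) = f (o.eval x regs) := by
  cases o with
  | const c => simp [Operand.eval]
  | var i => rfl
  | reg j =>
    simp only [Operand.eval]
    rw [← map_zero f, List.getD_map]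

theorem Instr.eval_map (f : K →+* L) (x : ι → K) (regs : List K) (a : Instr ι) :
    a.eval (fun i => f (x i)) (regs.map f) = f (a.eval x regs) := by
  obtain ⟨op, l, r⟩ := a
  cases op <;> simp [Instr.eval, RingOp.eval, Operand.eval_map]

theorem runCode_map (f : K →+* L) (x : ι → K) (code : List (Instr ι)) :
    runCode (fun i => f (x i)) code = (runCode x code).map f := by
  induction code using List.reverseRecOn with
  | nil => rfl
  | append_singleton l a ih => simp [runCode_concat, ih, Instr.eval_map]

theorem AlgProgram.eval_map (P : AlgProgram ι κ) (f : K →+* L) (x : ι → K) (o : κ) :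
    P.eval (fun i => f (x i)) o = f (P.eval x o) := by
  change (P.out o).eval _ (runCode _ P.code) = f ((P.out o).eval x (runCode x P.code))
  rw [runCode_map, Operand.eval_map]

end runCode

/-- A program that multiplies integer matrices multiplies matrices over every commutative ring. -/
theorem AlgProgram.Multiplies.eval_eq {s n : ℕ}
    {P : AlgProgram ((Fin s × Fin n) ⊕ (Fin n × Fin n)) (Fin s × Fin n)} (hP : P.Multiplies)
    {K : Type*} [CommRing K] (S : Matrix (Fin s) (Fin n) K) (T : Matrix (Fin n) (Fin n) K)
    (i : Fin s) (j : Fin n) :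
    P.eval (Sum.elim (fun p => S p.1 p.2) (fun p => T p.1 p.2)) (i, j) = (S * T) i j := by
  let ι := (Fin s × Fin n) ⊕ (Fin n × Fin n)
  -- Agreement at all integer points is an identity of integer polynomials, and this specialises to
  -- every commutative ring.
  have key : P.eval (fun k : ι => (MvPolynomial.X k : MvPolynomial ι ℤ)) (i, j) =
      ∑ k, MvPolynomial.X (Sum.inl (i, k)) * MvPolynomial.X (Sum.inr (k, j)) := by
    refine MvPolynomial.funext fun x => ?_
    rw [← P.eval_map (MvPolynomial.eval x)]
    have := hP (Matrix.of fun a b => x (Sum.inl (a, b)))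
      (Matrix.of fun a b => x (Sum.inr (a, b))) i j
    simp only [Matrix.mul_apply, Matrix.of_apply] at this
    simp only [MvPolynomial.eval_X, map_sum, map_mul]
    rw [← this]
    congr 1
    funext k
    rcases k with ⟨a, b⟩ | ⟨a, b⟩ <;> rfl
  let x : ι → K := Sum.elim (fun p => S p.1 p.2) (fun p => T p.1 p.2)
  have h2 := congrArg (MvPolynomial.eval₂Hom (Int.castRingHom K) x) key
  rw [← P.eval_map] at h2
  simp only [MvPolynomial.coe_eval₂Hom, MvPolynomial.eval₂_X, MvPolynomial.eval₂_sum,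
    MvPolynomial.eval₂_mul] at h2
  exact h2

/-! ### Bilinear algorithms -/

section Bilinear

variable {K X Y : Type} [CommRing K]

/-- The span of the products `u x * v y`, for `(u, v)` in a list. -/
def productSpan (l : List ((X → K) × (Y → K))) : Submodule K (X → Y → K) :=
  Submodule.span K {f | ∃ p ∈ l, f = fun x y => p.1 x * p.2 y}

theorem productSpan_mono {l l' : List ((X → K) × (Y → K))} (h : l ⊆ l') :
    productSpan l ≤ productSpan l' :=
  Submodule.span_mono fun _ ⟨p, hp, hf⟩ => ⟨p, h hp, hf⟩

theorem mem_productSpan {l : List ((X → K) × (Y → K))} {p : (X → K) × (Y → K)} (hp : p ∈ l) :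
    (fun x y => p.1 x * p.2 y) ∈ productSpan l :=
  Submodule.subset_span ⟨p, hp, rfl⟩

/-- The value `φ x y` is a constant, plus `ε₂` times a function of `y`, plus `ε₁` times a function
of `x`, plus `ε₁ ε₂` times an element of the product span. -/
def HasProductPart (l : List ((X → K) × (Y → K))) (φ : X → Y → DualNumber (DualNumber K)) : Prop :=
  ∃ (c : K) (a : X → K) (b : Y → K) (d : X → Y → K), d ∈ productSpan l ∧ ∀ x y,
    (φ x y).fst.fst = c ∧ (φ x y).fst.snd = b y ∧ (φ x y).snd.fst = a x ∧ (φ x y).snd.snd = d x y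

theorem HasProductPart.mono {l l' : List ((X → K) × (Y → K))}
    {φ : X → Y → DualNumber (DualNumber K)} (h : HasProductPart l φ) (hl : l ⊆ l') :
    HasProductPart l' φ := by
  obtain ⟨c, a, b, d, hd, h⟩ := h
  exact ⟨c, a, b, d, productSpan_mono hl hd, h⟩

/-- Only multiplication creates new products: the mixed coefficient of a product is `c * d' + c' * d
+ a * b' + a' * b`, where the last two terms are the two pairs added to the list. -/
theorem HasProductPart.op {l : List ((X → K) × (Y → K))}
    {φ ψ : X → Y → DualNumber (DualNumber K)} (hφ : HasProductPart l φ) (hψ : HasProductPart l ψ)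
    (o : RingOp) :
    ∃ p q, HasProductPart (p :: q :: l) (fun x y => o.eval (φ x y) (ψ x y)) := by
  obtain ⟨c, a, b, d, hd, h⟩ := hφ
  obtain ⟨c', a', b', d', hd', h'⟩ := hψ
  refine ⟨(a, b'), (a', b), ?_⟩
  have hsub : l ⊆ (a, b') :: (a', b) :: l :=
    fun z hz => List.mem_cons_of_mem _ (List.mem_cons_of_mem _ hz)
  have hd := productSpan_mono hsub hd
  have hd' := productSpan_mono hsub hd'
  cases o with
  | add =>
    refine ⟨c + c', a + a', b + b', d + d', Submodule.add_mem _ hd hd', fun x y => ?_⟩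
    obtain ⟨h1, h2, h3, h4⟩ := h x y
    obtain ⟨h1', h2', h3', h4'⟩ := h' x y
    simp [RingOp.eval, h1, h2, h3, h4, h1', h2', h3', h4']
  | sub =>
    refine ⟨c - c', a - a', b - b', d - d', Submodule.sub_mem _ hd hd', fun x y => ?_⟩
    obtain ⟨h1, h2, h3, h4⟩ := h x y
    obtain ⟨h1', h2', h3', h4'⟩ := h' x y
    simp [RingOp.eval, h1, h2, h3, h4, h1', h2', h3', h4']
  | mul =>
    refine ⟨c * c', fun x => c * a' x + a x * c', fun y => c * b' y + b y * c',
      c • d' + c' • d + ((fun x y => a x * b' y) + fun x y => a' x * b y), ?_, fun x y => ?_⟩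
    · refine Submodule.add_mem _ (Submodule.add_mem _ (Submodule.smul_mem _ _ hd')
        (Submodule.smul_mem _ _ hd)) (Submodule.add_mem _ ?_ ?_)
      · exact mem_productSpan (p := (a, b')) (by simp)
      · exact mem_productSpan (p := (a', b)) (by simp)
    · obtain ⟨h1, h2, h3, h4⟩ := h x y
      obtain ⟨h1', h2', h3', h4'⟩ := h' x y
      simp only [RingOp.eval, TrivSqZeroExt.fst_mul, DualNumber.snd_mul, TrivSqZeroExt.fst_add,
        TrivSqZeroExt.snd_add, h1, h2, h3, h4, h1', h2', h3', h4', Pi.add_apply, Pi.smul_apply,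
        smul_eq_mul, true_and]
      ring

theorem hasProductPart_intCast (l : List ((X → K) × (Y → K))) (c : ℤ) :
    HasProductPart l (fun _ _ => (c : DualNumber (DualNumber K))) :=
  ⟨c, 0, 0, 0, Submodule.zero_mem _, fun _ _ => by simp⟩

theorem Operand.hasProductPart {ι : Type} {l : List ((X → K) × (Y → K))}
    {inp : X → Y → ι → DualNumber (DualNumber K)}
    {regs : X → Y → List (DualNumber (DualNumber K))}
    (hinp : ∀ i, HasProductPart l fun x y => inp x y i)
    (hregs : ∀ j, HasProductPart l fun x y => (regs x y).getD j 0) (o : Operand ι) :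
    HasProductPart l fun x y => o.eval (inp x y) (regs x y) := by
  cases o with
  | const c => exact hasProductPart_intCast l c
  | var i => exact hinp i
  | reg j => exact hregs j

/-- Each instruction contributes two products. A reference past the end reads `0`, which is
harmless. -/
theorem exists_hasProductPart_runCode {ι : Type} (inp : X → Y → ι → DualNumber (DualNumber K))
    (hinp : ∀ l i, HasProductPart l fun x y => inp x y i) (code : List (Instr ι)) :
    ∃ l : List ((X → K) × (Y → K)), l.length ≤ 2 * code.length ∧
      ∀ j, HasProductPart l fun x y => (runCode (inp x y) code).getD j 0 := by
  induction code using List.reverseRecOn with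
  | nil =>
    refine ⟨[], by simp, fun j => ?_⟩
    have := hasProductPart_intCast (X := X) (Y := Y) (K := K) [] 0
    simpa using this
  | append_singleton code a ih =>
    obtain ⟨l, hl, h⟩ := ih
    obtain ⟨p, q, hpq⟩ := (Operand.hasProductPart (hinp l) h a.left).op
      (Operand.hasProductPart (hinp l) h a.right) a.op
    refine ⟨p :: q :: l, by simp; omega, fun j => ?_⟩
    have hsub : l ⊆ p :: q :: l :=
      fun z hz => List.mem_cons_of_mem _ (List.mem_cons_of_mem _ hz)
    rcases lt_trichotomy j code.length with hj | hj | hj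
    · have : (fun x y => (runCode (inp x y) (code ++ [a])).getD j 0) =
          fun x y => (runCode (inp x y) code).getD j 0 := by
        funext x y
        rw [runCode_concat, List.getD_append _ _ _ _ (by simpa using hj)]
      rw [this]
      exact (h j).mono hsub
    · have : (fun x y => (runCode (inp x y) (code ++ [a])).getD j 0) =
          fun x y => a.eval (inp x y) (runCode (inp x y) code) := by
        funext x y
        rw [runCode_concat, List.getD_append_right _ _ _ _ (by simp [hj])]
        simp [hj]
      rw [this]
      exact hpq
    · have : (fun x y => (runCode (inp x y) (code ++ [a])).getD j 0) = fun x y => 0 := by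
        funext x y
        refine List.getD_eq_default _ _ ?_
        simp; omega
      rw [this]
      simpa using hasProductPart_intCast (X := X) (Y := Y) (K := K) (p :: q :: l) 0

/-- The product of `s × n` and `n × n` matrices is a combination of `m` products of a function
of the first factor and a function of the second factor. -/
structure IsBilinearAlgorithm {s n m : ℕ} (α : Fin m → Matrix (Fin s) (Fin n) K → K)
    (β : Fin m → Matrix (Fin n) (Fin n) K → K) (γ : Fin s → Fin n → Fin m → K) : Prop where
  sum_eq : ∀ S T i j, ∑ t, γ i j t * (α t S * β t T) = (S * T) i j

/-- Strassen's homogenization: a program with `k` operations yields at most `2 * k` products. -/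
theorem AlgProgram.Multiplies.exists_isBilinearAlgorithm {s n : ℕ}
    {P : AlgProgram ((Fin s × Fin n) ⊕ (Fin n × Fin n)) (Fin s × Fin n)} (hP : P.Multiplies)
    (K : Type) [CommRing K] :
    ∃ m ≤ 2 * P.ops, ∃ (α : Fin m → Matrix (Fin s) (Fin n) K → K)
      (β : Fin m → Matrix (Fin n) (Fin n) K → K) (γ : Fin s → Fin n → Fin m → K),
      IsBilinearAlgorithm α β γ := by
  -- Entries of `S` are multiplied by `ε₁` and those of `T` by `ε₂`, so `(S * T) i j` is the
  -- coefficient of `ε₁ ε₂` in the output.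
  let inp : Matrix (Fin s) (Fin n) K → Matrix (Fin n) (Fin n) K →
      ((Fin s × Fin n) ⊕ (Fin n × Fin n)) → DualNumber (DualNumber K) := fun S T =>
    Sum.elim (fun p => TrivSqZeroExt.inr (TrivSqZeroExt.inl (S p.1 p.2)))
      (fun p => TrivSqZeroExt.inl (TrivSqZeroExt.inr (T p.1 p.2)))
  have hinp : ∀ l i, HasProductPart l fun S T => inp S T i := by
    rintro l (p | p)
    · exact ⟨0, fun S => S p.1 p.2, 0, 0, Submodule.zero_mem _, fun S T => by simp [inp]⟩
    · exact ⟨0, 0, fun T => T p.1 p.2, 0, Submodule.zero_mem _, fun S T => by simp [inp]⟩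
  obtain ⟨l, hl, hregs⟩ := exists_hasProductPart_runCode inp hinp P.code
  have hout : ∀ i j, (fun (S : Matrix (Fin s) (Fin n) K) T => (S * T) i j) ∈ productSpan l := by
    intro i j
    obtain ⟨c, a, b, d, hd, h⟩ := Operand.hasProductPart (hinp l) hregs (P.out (i, j))
    have : (fun (S : Matrix (Fin s) (Fin n) K) T => (S * T) i j) = d := by
      funext S T
      refine Eq.trans ?_ (h S T).2.2.2
      have h2 := hP.eval_eq (K := DualNumber (DualNumber K))
        (Matrix.of fun a b => TrivSqZeroExt.inr (TrivSqZeroExt.inl (S a b)))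
        (Matrix.of fun a b => TrivSqZeroExt.inl (TrivSqZeroExt.inr (T a b))) i j
      change (P.out (i, j)).eval (inp S T) (runCode (inp S T) P.code) = _ at h2
      beta_reduce
      rw [h2]
      simp only [Matrix.mul_apply, Matrix.of_apply, TrivSqZeroExt.snd_sum, TrivSqZeroExt.snd_mul]
      simp [mul_comm]
    rw [this]
    exact hd
  have hspan : productSpan l = Submodule.span K (Set.range fun t : Fin l.length =>
      fun (S : Matrix (Fin s) (Fin n) K) (T : Matrix (Fin n) (Fin n) K) =>
        (l.get t).1 S * (l.get t).2 T) := by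
    unfold productSpan
    congr 1
    ext f
    constructor
    · rintro ⟨p, hp, rfl⟩
      obtain ⟨t, rfl⟩ := List.mem_iff_get.mp hp
      exact ⟨t, rfl⟩
    · rintro ⟨t, rfl⟩
      exact ⟨_, List.get_mem _ _, rfl⟩
  have hγ : ∀ i j, ∃ γ : Fin l.length → K, ∑ t, γ t •
      (fun (S : Matrix (Fin s) (Fin n) K) (T : Matrix (Fin n) (Fin n) K) =>
        (l.get t).1 S * (l.get t).2 T) = fun S T => (S * T) i j := by
    intro i j
    have := hout i j
    rw [hspan] at this
    exact (Submodule.mem_span_range_iff_exists_fun K).mp this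
  choose γ hγ using hγ
  refine ⟨l.length, hl, fun t => (l.get t).1, fun t => (l.get t).2, γ, ⟨fun S T i j => ?_⟩⟩
  have := congrFun (congrFun (hγ i j) S) T
  simpa [Finset.sum_apply] using this

/-- The rank bound `n ^ 2 ≤ m`, by counting over a finite field. -/
theorem IsBilinearAlgorithm.sq_le [Fintype K] [Nontrivial K] {s n m : ℕ} (hs : 0 < s)
    {α : Fin m → Matrix (Fin s) (Fin n) K → K} {β : Fin m → Matrix (Fin n) (Fin n) K → K}
    {γ : Fin s → Fin n → Fin m → K} (h : IsBilinearAlgorithm α β γ) : n ^ 2 ≤ m := by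
  classical
  have hinj : Function.Injective fun (T : Matrix (Fin n) (Fin n) K) (t : Fin m) => β t T := by
    intro T T' hT
    ext k j
    -- Every row of `S` is the `k`-th unit vector, so the product exhibits row `k` of `T`; hence the
    -- values `β t T` determine `T`.
    let S : Matrix (Fin s) (Fin n) K := Matrix.of fun _ l => if l = k then 1 else 0
    have h1 := h.sum_eq S T ⟨0, hs⟩ j
    have h2 := h.sum_eq S T' ⟨0, hs⟩ j
    have h3 : ∀ t, β t T = β t T' := fun t => congrFun hT t
    simp only [h3] at h1
    rw [h1] at h2
    simpa [Matrix.mul_apply, S] using h2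
  have hc := Fintype.card_le_of_injective _ hinj
  have h1 : Fintype.card (Matrix (Fin n) (Fin n) K) = Fintype.card K ^ (n ^ 2) := by
    have : Fintype.card (Fin n → Fin n → K) = Fintype.card K ^ (n ^ 2) := by
      simp [sq, pow_mul]
    convert this
  rw [h1] at hc
  simp only [Fintype.card_pi, Finset.prod_const, Finset.card_univ, Fintype.card_fin] at hc
  exact (Nat.pow_le_pow_iff_right Fintype.one_lt_card).mp hc

end Bilinear

/-! ### Composition of straight-line programs -/

/-- Replace variables by variables or constants and shift the references to earlier results. -/
def Operand.transform {ι ι' : Type} (f : ι → ι' ⊕ ℤ) (k : ℕ) : Operand ι → Operand ι'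
  | .const c => .const c
  | .var i => Sum.elim Operand.var Operand.const (f i)
  | .reg j => .reg (k + j)

/-- `Operand.transform` on both operands. -/
def Instr.transform {ι ι' : Type} (f : ι → ι' ⊕ ℤ) (k : ℕ) (a : Instr ι) : Instr ι' :=
  ⟨a.op, a.left.transform f k, a.right.transform f k⟩

/-- Replace references to results beyond the first `k` by `0`. -/
def Operand.clip {ι : Type} (k : ℕ) : Operand ι → Operand ι
  | .const c => .const c
  | .var i => .var i
  | .reg j => if j < k then .reg j else .const 0

theorem Operand.eval_transform {ι ι' : Type} (f : ι → ι' ⊕ ℤ) (x : ι' → ℤ) (pre regs : List ℤ)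
    (o : Operand ι) :
    (o.transform f pre.length).eval x (pre ++ regs) =
      o.eval (fun i => Sum.elim x id (f i)) regs := by
  cases o with
  | const c => rfl
  | var i => rcases h : f i with i' | c <;> simp [Operand.transform, Operand.eval, h]
  | reg j => simp [Operand.transform, Operand.eval, List.getElem?_append_right]

theorem Operand.eval_clip {ι : Type} (x : ι → ℤ) (regs post : List ℤ) (o : Operand ι) :
    (o.clip regs.length).eval x (regs ++ post) = o.eval x regs := by
  cases o with
  | const c => rfl
  | var i => rfl
  | reg j =>
    simp only [Operand.clip]
    split_ifs with h
    · simp [Operand.eval, List.getElem?_append_left h]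
    · simp [Operand.eval, List.getElem?_eq_none (not_lt.mp h)]

theorem runCode_append_transform {ι ι' : Type} (f : ι → ι' ⊕ ℤ) (x : ι' → ℤ)
    (pre : List (Instr ι')) (code : List (Instr ι)) :
    runCode x (pre ++ code.map (Instr.transform f pre.length)) =
      runCode x pre ++ runCode (fun i => Sum.elim x id (f i)) code := by
  induction code using List.reverseRecOn with
  | nil => simp
  | append_singleton l a ih =>
    rw [List.map_append, ← List.append_assoc, List.map_singleton, runCode_concat, runCode_concat,
      ih, ← List.append_assoc]
    congr 2
    have h := fun o => Operand.eval_transform f x (runCode x pre)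
      (runCode (fun i => Sum.elim x id (f i)) l) o
    simp only [length_runCode] at h
    simp only [Instr.eval, Instr.transform, h]

/-- Some straight-line program with at most `c` operations computes `F` on integers. -/
def Computes {ι κ : Type} (c : ℕ) (F : (ι → ℤ) → κ → ℤ) : Prop :=
  ∃ P : AlgProgram ι κ, P.ops ≤ c ∧ ∀ x, P.eval x = F x

section Computes

variable {ι ι' κ κ' : Type} {c c' : ℕ}

theorem Computes.subst {F : (ι → ℤ) → κ → ℤ} (h : Computes c F) (f : ι → ι' ⊕ ℤ) (g : κ' → κ) :
    Computes c fun x o => F (fun i => Sum.elim x id (f i)) (g o) := by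
  obtain ⟨P, hc, hP⟩ := h
  refine ⟨⟨P.code.map (Instr.transform f 0), fun o => (P.out (g o)).transform f 0⟩,
    by simpa [AlgProgram.ops] using hc, fun x => funext fun o => ?_⟩
  beta_reduce
  rw [← hP]
  change Operand.eval x (runCode x (P.code.map (Instr.transform f 0)))
    ((P.out (g o)).transform f 0) = (P.out (g o)).eval _ (runCode _ P.code)
  have := runCode_append_transform f x [] P.code
  simp only [List.nil_append, List.length_nil, runCode_nil] at this
  rw [this]
  exact Operand.eval_transform f x [] _ _

/-- The two programs are concatenated. The outputs of the first are clipped, because a dangling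
reference, which used to read `0`, would now read a result of the second. -/
theorem Computes.sumElim {F : (ι → ℤ) → κ → ℤ} {F' : (ι → ℤ) → κ' → ℤ} (h : Computes c F)
    (h' : Computes c' F') : Computes (c + c') fun x => Sum.elim (F x) (F' x) := by
  obtain ⟨P, hc, hP⟩ := h
  obtain ⟨Q, hc', hQ⟩ := h'
  refine ⟨⟨P.code ++ Q.code.map (Instr.transform Sum.inl P.code.length),
    Sum.elim (fun o => (P.out o).clip P.code.length)
      (fun o => (Q.out o).transform Sum.inl P.code.length)⟩, ?_, fun x => funext fun o => ?_⟩
  · simp only [AlgProgram.ops, List.length_append, List.length_map] at *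
    omega
  · beta_reduce
    rw [← hP, ← hQ]
    have key := runCode_append_transform (ι := ι) Sum.inl x P.code Q.code
    simp only [Sum.elim_inl] at key
    rcases o with o | o
    · change Operand.eval x (runCode x _) ((P.out o).clip P.code.length) =
        (P.out o).eval x (runCode x P.code)
      rw [key]
      have := Operand.eval_clip x (runCode x P.code) (runCode x Q.code) (P.out o)
      rwa [length_runCode] at this
    · change Operand.eval x (runCode x _) ((Q.out o).transform Sum.inl P.code.length) =
        (Q.out o).eval x (runCode x Q.code)
      rw [key]
      have := Operand.eval_transform Sum.inl x (runCode x P.code) (runCode x Q.code) (Q.out o)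
      rwa [length_runCode] at this

theorem Computes.family {p : ℕ} {F : Fin p → (ι → ℤ) → κ → ℤ} (h : ∀ b, Computes c (F b)) :
    Computes (p * c) fun x (bo : Fin p × κ) => F bo.1 x bo.2 := by
  induction p with
  | zero => exact ⟨⟨[], fun o => o.1.elim0⟩, by simp [AlgProgram.ops],
      fun x => funext fun o => o.1.elim0⟩
  | succ p ih =>
    have h1 := (ih (F := fun b => F b.castSucc) (fun b => h _)).sumElim (h (Fin.last p))
    have h2 := h1.subst (ι' := ι) Sum.inl (fun bo : Fin (p + 1) × κ =>
      Fin.lastCases (motive := fun _ => Fin p × κ ⊕ κ) (Sum.inr bo.2)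
        (fun b => Sum.inl (b, bo.2)) bo.1)
    rw [show (p + 1) * c = p * c + c by ring]
    convert h2 using 1
    funext x ⟨b, o⟩
    refine Fin.lastCases ?_ (fun b => ?_) b <;> simp

theorem computes_sum_mul (l : List (ι × ι)) :
    Computes (2 * l.length) fun x (_ : Unit) => (l.map fun p => x p.1 * x p.2).sum := by
  induction l with
  | nil => exact ⟨⟨[], fun _ => .const 0⟩, by simp [AlgProgram.ops], fun x => by
      funext o; simp [AlgProgram.eval, Operand.eval]⟩
  | cons p l ih =>
    obtain ⟨P, hc, hP⟩ := ih
    refine ⟨⟨P.code ++ [⟨.mul, .var p.1, .var p.2⟩] ++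
      [⟨.add, .reg P.code.length, (P.out ()).clip P.code.length⟩], fun _ => .reg (P.code.length + 1)⟩,
      ?_, fun x => funext fun o => ?_⟩
    · simp only [AlgProgram.ops, List.length_append, List.length_cons, List.length_nil] at *
      omega
    · have h1 : (P.out ()).eval x (runCode x P.code) = _ := congrFun (hP x) ()
      change Operand.eval x (runCode x _) (.reg (P.code.length + 1)) = _
      rw [runCode_concat, runCode_concat]
      have h2 := Operand.eval_clip x (runCode x P.code)
        [Instr.eval x (runCode x P.code) ⟨.mul, .var p.1, .var p.2⟩] (P.out ())
      rw [length_runCode] at h2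
      simp only [Operand.eval]
      rw [List.getD_append_right _ _ _ _ (by simp)]
      simp only [List.length_append, length_runCode, List.length_singleton, Nat.sub_self,
        List.getD_cons_zero, List.map_cons, List.sum_cons]
      change RingOp.eval .add (Operand.eval x _ _) (Operand.eval x _ _) = _
      rw [h2, h1]
      simp [RingOp.eval, Operand.eval, Instr.eval]

end Computes

/-! ### The exponent of rectangular matrix multiplication -/

/-- The entries of a matrix product as functions of the entries of the factors. -/
def mulEntries (s n : ℕ) (x : (Fin s × Fin n) ⊕ (Fin n × Fin n) → ℤ) (o : Fin s × Fin n) : ℤ :=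
  ∑ k, x (Sum.inl (o.1, k)) * x (Sum.inr (k, o.2))

theorem multiplies_iff {s n : ℕ}
    {P : AlgProgram ((Fin s × Fin n) ⊕ (Fin n × Fin n)) (Fin s × Fin n)} :
    P.Multiplies ↔ ∀ x, P.eval x = mulEntries s n x := by
  constructor
  · intro h x
    funext ⟨i, j⟩
    have h1 := h (Matrix.of fun a b => x (Sum.inl (a, b))) (Matrix.of fun a b => x (Sum.inr (a, b)))
      i j
    have hx : Sum.elim
        (fun p : Fin s × Fin n => (Matrix.of fun a b => x (Sum.inl (a, b))) p.1 p.2)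
        (fun p : Fin n × Fin n => (Matrix.of fun a b => x (Sum.inr (a, b))) p.1 p.2) = x := by
      funext k
      rcases k with k | k <;> rfl
    rw [hx] at h1
    rw [h1]
    simp [Matrix.mul_apply, mulEntries]
  · intro h S T i j
    rw [h]
    simp [Matrix.mul_apply, mulEntries]

/-- The `s'` rows are cut into `p` strips of `s` rows, the missing rows filled with the constant
`0`, and the strips multiplied one by one. -/
theorem Computes.mulEntries_mono {s s' n p c : ℕ} (h : Computes c (mulEntries s n))
    (hs : s' ≤ p * s) : Computes (p * c) (mulEntries s' n) := by
  have h1 : ∀ b : Fin p, Computes c fun (x : (Fin s' × Fin n) ⊕ (Fin n × Fin n) → ℤ) o =>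
      mulEntries s n (fun i => Sum.elim x id
        (Sum.elim (fun ik : Fin s × Fin n => if h : b * s + ik.1 < s' then
          Sum.inl (Sum.inl (⟨b * s + ik.1, h⟩, ik.2)) else Sum.inr (0 : ℤ))
          (fun kj : Fin n × Fin n => Sum.inl (Sum.inr kj)) i)) o :=
    fun b => h.subst _ id
  have hlt : ∀ i : Fin s', (i : ℕ) / s < p := fun i =>
    Nat.div_lt_of_lt_mul (lt_of_lt_of_le i.2 (by rwa [mul_comm]))
  have hpos : ∀ i : Fin s', 0 < s := fun i => by
    have := lt_of_lt_of_le (Fin.pos i) hs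
    exact Nat.pos_of_mul_pos_left this
  have h2 := (Computes.family h1).subst (ι' := (Fin s' × Fin n) ⊕ (Fin n × Fin n)) Sum.inl
    (fun ij : Fin s' × Fin n =>
      ((⟨(ij.1 : ℕ) / s, hlt ij.1⟩ : Fin p), ((⟨(ij.1 : ℕ) % s, Nat.mod_lt _ (hpos ij.1)⟩ : Fin s),
        ij.2)))
  convert h2 using 1
  funext x ⟨i, j⟩
  have hi : (i : ℕ) / s * s + (i : ℕ) % s = i := by rw [mul_comm]; exact Nat.div_add_mod _ _
  simp [mulEntries, hi]

theorem computes_mulEntries_one (n : ℕ) : Computes (n * (2 * n)) (mulEntries 1 n) := by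
  have h1 : ∀ j : Fin n, Computes (2 * n)
      fun (x : (Fin 1 × Fin n) ⊕ (Fin n × Fin n) → ℤ) (_ : Unit) =>
        ((List.ofFn fun k : Fin n =>
          ((Sum.inl (0, k), Sum.inr (k, j)) : ((Fin 1 × Fin n) ⊕ (Fin n × Fin n)) ×
            ((Fin 1 × Fin n) ⊕ (Fin n × Fin n)))).map fun p => x p.1 * x p.2).sum := by
    intro j
    have := computes_sum_mul (List.ofFn fun k : Fin n =>
          ((Sum.inl (0, k), Sum.inr (k, j)) : ((Fin 1 × Fin n) ⊕ (Fin n × Fin n)) ×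
            ((Fin 1 × Fin n) ⊕ (Fin n × Fin n))))
    rwa [List.length_ofFn] at this
  have h2 := (Computes.family h1).subst (ι' := (Fin 1 × Fin n) ⊕ (Fin n × Fin n)) Sum.inl
    (fun ij : Fin 1 × Fin n => (ij.2, ()))
  convert h2 using 1
  funext x ⟨i, j⟩
  obtain rfl : i = 0 := Subsingleton.elim _ _
  simp [mulEntries, List.map_ofFn, List.sum_ofFn]

theorem hasMMExponent_iff {r σ : ℝ} : HasMMExponent r σ ↔ ∃ C : ℝ, ∀ n : ℕ, 1 ≤ n →
    ∃ c : ℕ, Computes c (mulEntries ⌈(n : ℝ) ^ r⌉₊ n) ∧ (c : ℝ) ≤ C * (n : ℝ) ^ σ := by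
  constructor
  · rintro ⟨C, h⟩
    refine ⟨C, fun n hn => ?_⟩
    obtain ⟨P, hP, hc⟩ := h n hn
    exact ⟨P.ops, ⟨P, le_rfl, multiplies_iff.mp hP⟩, hc⟩
  · rintro ⟨C, h⟩
    refine ⟨C, fun n hn => ?_⟩
    obtain ⟨c, ⟨P, hPc, hP⟩, hc⟩ := h n hn
    exact ⟨P, multiplies_iff.mpr hP, le_trans (by exact_mod_cast hPc) hc⟩

theorem HasMMExponent.nonneg {r σ C : ℝ} (h : ∀ n : ℕ, 1 ≤ n →
    ∃ c : ℕ, Computes c (mulEntries ⌈(n : ℝ) ^ r⌉₊ n) ∧ (c : ℝ) ≤ C * (n : ℝ) ^ σ) : 0 ≤ C := by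
  obtain ⟨c, _, hc⟩ := h 1 le_rfl
  simp only [Nat.cast_one, Real.one_rpow, mul_one] at hc
  exact le_trans (Nat.cast_nonneg c) hc

theorem HasMMExponent.mono {x σ σ' : ℝ} (h : HasMMExponent x σ) (hσ : σ ≤ σ') :
    HasMMExponent x σ' := by
  rw [hasMMExponent_iff] at h ⊢
  obtain ⟨C, h⟩ := h
  refine ⟨C, fun n hn => ?_⟩
  have hC := HasMMExponent.nonneg h
  obtain ⟨c, h1, h2⟩ := h n hn
  refine ⟨c, h1, h2.trans ?_⟩
  have : (1 : ℝ) ≤ n := by exact_mod_cast hn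
  gcongr

theorem HasMMExponent.antitone {x y σ : ℝ} (h : HasMMExponent x σ) (hy : y ≤ x) :
    HasMMExponent y σ := by
  rw [hasMMExponent_iff] at h ⊢
  obtain ⟨C, h⟩ := h
  refine ⟨C, fun n hn => ?_⟩
  obtain ⟨c, h1, h2⟩ := h n hn
  have h3 : (1 : ℝ) ≤ n := by exact_mod_cast hn
  refine ⟨1 * c, h1.mulEntries_mono ?_, by simpa using h2⟩
  rw [one_mul]
  exact Nat.ceil_le_ceil (Real.rpow_le_rpow_of_exponent_le h3 hy)

theorem natCeil_le_two_mul {x : ℝ} (hx : 1 ≤ x) : (⌈x⌉₊ : ℝ) ≤ 2 * x := by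
  have := (Nat.ceil_lt_add_one (zero_le_one.trans hx)).le
  linarith

/-- About `n ^ δ` strips of `n ^ x` rows are multiplied separately. This makes the exponent
Lipschitz. -/
theorem HasMMExponent.add {x σ δ : ℝ} (h : HasMMExponent x σ) (hδ : 0 ≤ δ) :
    HasMMExponent (x + δ) (σ + δ) := by
  rw [hasMMExponent_iff] at h ⊢
  obtain ⟨C, h⟩ := h
  refine ⟨2 * C, fun n hn => ?_⟩
  obtain ⟨c, h1, h2⟩ := h n hn
  have h3 : (1 : ℝ) ≤ n := by exact_mod_cast hn
  have h4 : (1 : ℝ) ≤ (n : ℝ) ^ δ := Real.one_le_rpow h3 hδ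
  have h0 : (0 : ℝ) < n := by linarith
  refine ⟨⌈(n : ℝ) ^ δ⌉₊ * c, h1.mulEntries_mono ?_, ?_⟩
  · rw [Nat.ceil_le, Real.rpow_add h0]
    push_cast
    rw [mul_comm]
    gcongr <;> exact Nat.le_ceil _
  · push_cast
    rw [Real.rpow_add h0]
    calc (⌈(n : ℝ) ^ δ⌉₊ : ℝ) * c ≤ (2 * (n : ℝ) ^ δ) * (C * (n : ℝ) ^ σ) := by
          gcongr
          exact natCeil_le_two_mul h4
      _ = _ := by ring

theorem hasMMExponent_zero_two : HasMMExponent 0 2 := by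
  rw [hasMMExponent_iff]
  refine ⟨2, fun n _ => ⟨n * (2 * n), ?_, ?_⟩⟩
  · rw [Real.rpow_zero, Nat.ceil_one]
    exact computes_mulEntries_one n
  · rw [show (2 : ℝ) = ((2 : ℕ) : ℝ) by norm_num, Real.rpow_natCast]
    push_cast
    exact le_of_eq (by ring)

theorem exists_hasMMExponent (x : ℝ) : ∃ σ, HasMMExponent x σ := by
  rcases le_total x 0 with h | h
  · exact ⟨2, hasMMExponent_zero_two.antitone h⟩
  · exact ⟨2 + x, by simpa using hasMMExponent_zero_two.add h⟩

/-- Rectangular multiplication programs yield bilinear algorithms over every commutative ring. -/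
theorem HasMMExponent.exists_isBilinearAlgorithm {x σ : ℝ} (h : HasMMExponent x σ) :
    ∃ C : ℕ, ∀ n : ℕ, 1 ≤ n → ∀ (K : Type) [CommRing K],
      ∃ m : ℕ, (m : ℝ) ≤ C * (n : ℝ) ^ σ ∧
        ∃ (α : Fin m → Matrix (Fin ⌈(n : ℝ) ^ x⌉₊) (Fin n) K → K)
          (β : Fin m → Matrix (Fin n) (Fin n) K → K)
          (γ : Fin ⌈(n : ℝ) ^ x⌉₊ → Fin n → Fin m → K), IsBilinearAlgorithm α β γ := by
  obtain ⟨C, h⟩ := h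
  refine ⟨⌈2 * C⌉₊, fun n hn K _ => ?_⟩
  obtain ⟨P, hP, hops⟩ := h n hn
  obtain ⟨m, hm, h⟩ := hP.exists_isBilinearAlgorithm K
  refine ⟨m, ?_, h⟩
  have h1 : (m : ℝ) ≤ 2 * P.ops := by exact_mod_cast hm
  have h2 : 2 * C ≤ (⌈2 * C⌉₊ : ℝ) := Nat.le_ceil _
  have h3 : (0 : ℝ) ≤ (n : ℝ) ^ σ := by positivity
  nlinarith

/-- The rank bound over `ZMod 2` gives `n ^ 2 ≤ C * n ^ σ` for all `n ≥ 1`, which fails for large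
`n` if `σ < 2`. -/
theorem HasMMExponent.two_le {x σ : ℝ} (h : HasMMExponent x σ) : 2 ≤ σ := by
  obtain ⟨C, h⟩ := h.exists_isBilinearAlgorithm
  by_contra! hσ
  have hlim : Filter.Tendsto (fun n : ℕ => (n : ℝ) ^ (2 - σ)) Filter.atTop Filter.atTop :=
    (tendsto_rpow_atTop (by linarith)).comp tendsto_natCast_atTop_atTop
  obtain ⟨n, hn1, hn⟩ :=
    ((Filter.eventually_ge_atTop 1).and (hlim.eventually_gt_atTop (C : ℝ))).exists
  have h0 : (0 : ℝ) < n := by exact_mod_cast hn1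
  obtain ⟨m, hm, α, β, γ, hb⟩ := h n hn1 (ZMod 2)
  have h1 := hb.sq_le (Nat.ceil_pos.mpr (by positivity))
  have h2 : (n : ℝ) ^ (2 : ℝ) ≤ m := by
    rw [show (2 : ℝ) = ((2 : ℕ) : ℝ) by norm_num, Real.rpow_natCast]
    exact_mod_cast h1
  have h3 : (n : ℝ) ^ (2 : ℝ) = (n : ℝ) ^ (2 - σ) * (n : ℝ) ^ σ := by
    rw [← Real.rpow_add h0]; congr 1; ring
  have h4 : (0 : ℝ) < (n : ℝ) ^ σ := by positivity
  rw [h3] at h2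
  nlinarith [mul_lt_mul_of_pos_right hn h4]

theorem bddBelow_hasMMExponent (x : ℝ) : BddBelow {σ | HasMMExponent x σ} :=
  ⟨2, fun _ h => h.two_le⟩

theorem two_le_mmExponent (x : ℝ) : 2 ≤ mmExponent x :=
  le_csInf (exists_hasMMExponent x) fun _ h => HasMMExponent.two_le h

theorem hasMMExponent_of_lt {x σ : ℝ} (h : mmExponent x < σ) : HasMMExponent x σ := by
  obtain ⟨τ, hτ, hlt⟩ := exists_lt_of_csInf_lt (exists_hasMMExponent x) h
  exact HasMMExponent.mono hτ hlt.le

theorem mmExponent_mono : Monotone mmExponent := fun x _ hxy =>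
  csInf_le_csInf (bddBelow_hasMMExponent x) (exists_hasMMExponent _) fun _ h =>
    HasMMExponent.antitone h hxy

theorem mmExponent_add_le (x : ℝ) {δ : ℝ} (hδ : 0 ≤ δ) :
    mmExponent (x + δ) ≤ mmExponent x + δ := by
  rw [← sub_le_iff_le_add]
  refine le_csInf (exists_hasMMExponent x) fun σ hσ => ?_
  rw [sub_le_iff_le_add]
  exact csInf_le (bddBelow_hasMMExponent _) (HasMMExponent.add hσ hδ)

theorem continuous_mmExponent : Continuous mmExponent := by
  have h : LipschitzWith 1 mmExponent := by
    refine LipschitzWith.of_le_add fun x y => ?_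
    rcases le_total x y with h | h
    · exact (mmExponent_mono h).trans (le_add_of_nonneg_right dist_nonneg)
    · have := mmExponent_add_le y (sub_nonneg.mpr h)
      rw [add_sub_cancel] at this
      rwa [Real.dist_eq, abs_of_nonneg (sub_nonneg.mpr h)]
  exact h.continuous

/-- The equation that balances the shape of the blocks has exactly one solution. -/
theorem exists_unique_balanced {r : ℝ} (hr1 : r ≤ 1) :
    ∃ r' : ℝ, r' = 1 - (1 - r) * mmExponent r' ∧
      ∀ x : ℝ, x = 1 - (1 - r) * mmExponent x → x = r' := by
  have hr : 0 ≤ 1 - r := by linarith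
  let f : ℝ → ℝ := fun x => x + (1 - r) * mmExponent x
  have hf : Continuous f := continuous_id.add (continuous_const.mul continuous_mmExponent)
  have hmono : StrictMono f := fun x y hxy =>
    add_lt_add_of_lt_of_le hxy (mul_le_mul_of_nonneg_left (mmExponent_mono hxy.le) hr)
  -- As `a ≤ 1` and the exponent is monotone, `f a ≤ a + (1 - r) * mmExponent 1 = 1 ≤ f 1`.
  let a : ℝ := 1 - (1 - r) * mmExponent 1
  have h1 : 0 ≤ (1 - r) * mmExponent 1 := mul_nonneg hr (by linarith [two_le_mmExponent 1])
  have ha : a ≤ 1 := by simp only [a]; linarith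
  have hmem : (1 : ℝ) ∈ Set.Icc (f a) (f 1) := by
    refine ⟨?_, by simp only [f]; linarith⟩
    have := mul_le_mul_of_nonneg_left (mmExponent_mono ha) hr
    simp only [f]
    linarith
  obtain ⟨x, -, hx⟩ := intermediate_value_Icc ha hf.continuousOn hmem
  refine ⟨x, by simp only [f] at hx; linarith, fun y hy => hmono.injective ?_⟩
  rw [hx]
  simp only [f]
  linarith

/-! ### Matrix multiplication in the Congested Clique -/

theorem exists_balanced_map {X : Type} [Fintype X] {n k : ℕ} (h : Fintype.card X ≤ n * k) :
    ∃ f : X → Fin n, ∀ v, (Finset.univ.filter fun x => f x = v).card ≤ k := by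
  obtain ⟨e⟩ : Nonempty (X ↪ Fin n × Fin k) :=
    Function.Embedding.nonempty_of_card_le (by simpa using h)
  refine ⟨fun x => (e x).1, fun v => ?_⟩
  have := Finset.card_le_card_of_injOn (s := Finset.univ.filter fun x => (e x).1 = v)
    (t := (Finset.univ : Finset (Fin k))) (fun x => (e x).2) (fun _ _ => by simp) ?_
  · simpa using this
  · intro x hx y hy hxy
    simp only [Finset.coe_filter, Finset.mem_univ, true_and, Set.mem_ofPred_eq] at hx hy
    exact e.injective (Prod.ext (hx.trans hy.symm) hxy)

section Blocks

variable {R : Type} {s n p q g : ℕ}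

/-- The `(a', b')`-th block of a matrix whose rows and columns are placed in a `p × q` array of
`g × g` positions: the entries at the positions `((a, a'), (b, b'))`, filled up with zeros. -/
noncomputable def block [Zero R] (rp : Fin s ↪ Fin p × Fin g) (cp : Fin n ↪ Fin q × Fin g)
    (A : Matrix (Fin s) (Fin n) R) (a' b' : Fin g) : Matrix (Fin p) (Fin q) R :=
  Matrix.of fun a b =>
    Function.extend rp (fun i => Function.extend cp (A i) (fun _ => 0) (b, b')) (fun _ => 0) (a, a')

/-- This is what lets the owner of a block position evaluate functions of the block: it needs only
the entries placed there. -/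
theorem block_congr [Zero R] {rp : Fin s ↪ Fin p × Fin g} {cp : Fin n ↪ Fin q × Fin g}
    {A A' : Matrix (Fin s) (Fin n) R} {a' b' : Fin g}
    (h : ∀ i j, (rp i).2 = a' → (cp j).2 = b' → A i j = A' i j) :
    block rp cp A a' b' = block rp cp A' a' b' := by
  ext a b
  simp only [block, Matrix.of_apply]
  by_cases hi : ∃ i, rp i = (a, a')
  · obtain ⟨i, hi⟩ := hi
    rw [← hi, rp.injective.extend_apply, rp.injective.extend_apply]
    by_cases hj : ∃ j, cp j = (b, b')
    · obtain ⟨j, hj⟩ := hj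
      rw [← hj, cp.injective.extend_apply, cp.injective.extend_apply]
      exact h i j (by rw [hi]) (by rw [hj])
    · rw [Function.extend_apply' _ _ _ hj, Function.extend_apply' _ _ _ hj]
  · rw [Function.extend_apply' _ _ _ hi, Function.extend_apply' _ _ _ hi]

/-- Block multiplication: the sum over the inner index splits over the `q × g` positions, and unused
positions contribute zero. -/
theorem sum_block_mul_block [CommRing R] {t : ℕ} (rp : Fin s ↪ Fin p × Fin g)
    (cp : Fin n ↪ Fin q × Fin g) (dp : Fin t ↪ Fin q × Fin g) (A : Matrix (Fin s) (Fin n) R)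
    (B : Matrix (Fin n) (Fin t) R) (i : Fin s) (j : Fin t) :
    ∑ b', (block rp cp A (rp i).2 b' * block cp dp B b' (dp j).2) (rp i).1 (dp j).1 =
      (A * B) i j := by
  simp only [Matrix.mul_apply, block, Matrix.of_apply, Prod.mk.eta]
  rw [← Fintype.sum_prod_type_right (f := fun x : Fin q × Fin g =>
    Function.extend rp (fun i => Function.extend cp (A i) (fun _ => 0) x) (fun _ => 0) (rp i) *
      Function.extend cp (fun k => Function.extend dp (B k) (fun _ => 0) (dp j)) (fun _ => 0) x)]
  symm
  refine Fintype.sum_of_injective cp cp.injective _ _ ?_ ?_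
  · intro x hx
    rw [Function.extend_apply' (g := fun k => Function.extend dp (B k) (fun _ => 0) (dp j)) _ _ hx,
      mul_zero]
  · intro k
    simp only [rp.injective.extend_apply, cp.injective.extend_apply, dp.injective.extend_apply]

/-- A vertex in charge of at most `k` blocks receives at most `p * q` entries for each. -/
theorem card_filter_block_le {k : ℕ} (rp : Fin s ↪ Fin p × Fin g) (cp : Fin n ↪ Fin q × Fin g)
    {N : ℕ} {ν : Fin g × Fin g → Fin N}
    (hν : ∀ v, (Finset.univ.filter fun x => ν x = v).card ≤ k) (v : Fin N) :
    (Finset.univ.filter fun e : Fin s × Fin n => ν ((rp e.1).2, (cp e.2).2) = v).card ≤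
      p * q * k := by
  classical
  have h := Finset.card_le_card_of_injOn
    (s := Finset.univ.filter fun e : Fin s × Fin n => ν ((rp e.1).2, (cp e.2).2) = v)
    (t := (Finset.univ : Finset (Fin p × Fin q)) ×ˢ (Finset.univ.filter fun x => ν x = v))
    (fun e => (((rp e.1).1, (cp e.2).1), ((rp e.1).2, (cp e.2).2))) ?_ ?_
  · refine h.trans ?_
    rw [Finset.card_product]
    simp only [Finset.card_univ, Fintype.card_prod, Fintype.card_fin]
    exact Nat.mul_le_mul_left _ (hν v)
  · intro e he
    simpa using he
  · rintro e - e' - h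
    simp only [Prod.mk.injEq] at h
    exact Prod.ext (rp.injective (Prod.ext h.1.1 h.2.1)) (cp.injective (Prod.ext h.1.2 h.2.2))

end Blocks

theorem card_filter_fst_le {s n N : ℕ} {f : Fin s → Fin N} (hf : Function.Injective f) (v : Fin N) :
    (Finset.univ.filter fun e : Fin s × Fin n => f e.1 = v).card ≤ n := by
  have h := Finset.card_le_card_of_injOn
    (s := Finset.univ.filter fun e : Fin s × Fin n => f e.1 = v)
    (t := (Finset.univ : Finset (Fin n))) (fun e => e.2) (fun _ _ => by simp) ?_
  · simpa using h
  · intro e he e' he' h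
    simp only [Finset.coe_filter, Finset.mem_univ, true_and, Set.mem_ofPred_eq] at he he'
    exact Prod.ext (hf (he.trans he'.symm)) h

/-- The product of an `s × n` matrix by an `n × n` matrix over a finite ring, by means of a
bilinear algorithm with `m` products for `p × q` by `q × q` matrices, applied to the `p × q` array
of `g × g` blocks. -/
theorem Learns.matrix_mul {n s : ℕ} {I Ω : Type} {inp : Ω → Fin n → I} {T : ℕ}
    {ρ : Fin n → Ω → Ω → Prop} (h : Learns inp T ρ) {R : Type} [CommRing R] [Fintype R] {L : ℕ}
    (hR : Fintype.card R ≤ 2 ^ (Nat.clog 2 n * L))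
    {holderA : Ω → Fin s → Fin n} (hA : ∀ ω, Function.Injective (holderA ω))
    {holderB : Ω → Fin n → Fin n} (hB : ∀ ω, Function.Injective (holderB ω))
    {A : Ω → Matrix (Fin s) (Fin n) R} {B : Ω → Matrix (Fin n) (Fin n) R}
    (hρ : ∀ v ω ω', ρ v ω ω' → holderA ω = holderA ω' ∧ holderB ω = holderB ω' ∧
      (∀ i, holderA ω i = v → A ω i = A ω' i) ∧ ∀ i, holderB ω i = v → B ω i = B ω' i)
    {p q g m k c : ℕ} (hs : s ≤ p * g) (hn : n ≤ q * g) (hp : p * q ≤ n) (hq : q * q ≤ n)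
    (hg : g * g ≤ n * k) (hm : m ≤ n * c) (hk : 1 ≤ k) (hc : 1 ≤ c)
    {α : Fin m → Matrix (Fin p) (Fin q) R → R} {β : Fin m → Matrix (Fin q) (Fin q) R → R}
    {γ : Fin p → Fin q → Fin m → R} (hb : IsBilinearAlgorithm α β γ) :
    Learns inp (T + 24 * (k * c) * L) (fun v ω ω' => holderA ω = holderA ω' ∧
      ∀ i, holderA ω i = v → (A ω * B ω) i = (A ω' * B ω') i) := by
  classical
  have : Inhabited R := ⟨0⟩
  obtain ⟨rp⟩ : Nonempty (Fin s ↪ Fin p × Fin g) :=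
    Function.Embedding.nonempty_of_card_le (by simpa using hs)
  obtain ⟨cp⟩ : Nonempty (Fin n ↪ Fin q × Fin g) :=
    Function.Embedding.nonempty_of_card_le (by simpa using hn)
  -- `ν` assigns the block positions to vertices, at most `k` each, and `μ` the products, at most
  -- `c` each.
  obtain ⟨ν, hν⟩ := exists_balanced_map (X := Fin g × Fin g) (by simpa using hg)
  obtain ⟨μ, hμ⟩ := exists_balanced_map (X := Fin m) (by simpa using hm)
  have hkc : k ≤ k * c := Nat.le_mul_of_pos_right _ hc
  have hnkc : n ≤ n * (k * c) := Nat.le_mul_of_pos_right _ (by positivity)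
  have hblockA : ∀ v, (Finset.univ.filter fun e : Fin s × Fin n =>
      ν ((rp e.1).2, (cp e.2).2) = v).card ≤ n * (k * c) := fun v =>
    (card_filter_block_le rp cp hν v).trans (Nat.mul_le_mul hp hkc)
  have hblockB : ∀ v, (Finset.univ.filter fun e : Fin n × Fin n =>
      ν ((cp e.1).2, (cp e.2).2) = v).card ≤ n * (k * c) := fun v =>
    (card_filter_block_le cp cp hν v).trans (Nat.mul_le_mul hq hkc)
  have hνm : ∀ v, (Finset.univ.filter fun e : (Fin g × Fin g) × Fin m =>
      ν e.1 = v).card ≤ n * (k * c) := by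
    intro v
    rw [show (Finset.univ.filter fun e : (Fin g × Fin g) × Fin m => ν e.1 = v) =
      (Finset.univ.filter fun x => ν x = v) ×ˢ Finset.univ by ext; simp, Finset.card_product]
    simp only [Finset.card_univ, Fintype.card_fin]
    calc _ ≤ k * (n * c) := Nat.mul_le_mul (hν v) hm
      _ = _ := by ring
  have hμg : ∀ v, (Finset.univ.filter fun e : (Fin g × Fin g) × Fin m =>
      μ e.2 = v).card ≤ n * (k * c) := by
    intro v
    rw [show (Finset.univ.filter fun e : (Fin g × Fin g) × Fin m => μ e.2 = v) =
      Finset.univ ×ˢ (Finset.univ.filter fun x => μ x = v) by ext; simp, Finset.card_product]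
    simp only [Finset.card_univ, Fintype.card_prod, Fintype.card_fin]
    calc _ ≤ n * k * c := Nat.mul_le_mul hg (hμ v)
      _ = _ := by ring
  have h1 := h.route (K := k * c) hR (fun ω (e : Fin s × Fin n) => holderA ω e.1)
    (fun _ e => ν ((rp e.1).2, (cp e.2).2))
    (fun v ω ω' hv => ⟨by rw [(hρ v ω ω' hv).1], rfl⟩)
    (fun ω v => (card_filter_fst_le (hA ω) v).trans hnkc) (fun _ => hblockA)
    (fun ω e => A ω e.1 e.2)
    (fun ω ω' e hv => congrFun ((hρ _ ω ω' hv).2.2.1 e.1 rfl) e.2)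
  have h2 := h1.route (K := k * c) hR (fun ω (e : Fin n × Fin n) => holderB ω e.1)
    (fun _ e => ν ((cp e.1).2, (cp e.2).2))
    (fun v ω ω' hv => ⟨by rw [(hρ v ω ω' hv.1).2.1], rfl⟩)
    (fun ω v => (card_filter_fst_le (hB ω) v).trans hnkc) (fun _ => hblockB)
    (fun ω e => B ω e.1 e.2)
    (fun ω ω' e hv => congrFun ((hρ _ ω ω' hv.1).2.2.2 e.1 rfl) e.2)
  have h3 := h2.route (K := k * c) hR (fun _ (e : (Fin g × Fin g) × Fin m) => ν e.1)
    (fun _ e => μ e.2) (fun _ _ _ _ => ⟨rfl, rfl⟩) (fun _ => hνm) (fun _ => hμg)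
    (fun ω e => α e.2 (block rp cp (A ω) e.1.1 e.1.2))
    (fun ω ω' e hv => congrArg (α e.2) (block_congr fun i j hi hj =>
      hv.1.2 (i, j) (by simp only [hi, hj])))
  have h4 := h3.route (K := k * c) hR (fun _ (e : (Fin g × Fin g) × Fin m) => ν e.1)
    (fun _ e => μ e.2) (fun _ _ _ _ => ⟨rfl, rfl⟩) (fun _ => hνm) (fun _ => hμg)
    (fun ω e => β e.2 (block cp cp (B ω) e.1.1 e.1.2))
    (fun ω ω' e hv => congrArg (β e.2) (block_congr fun i j hi hj =>
      hv.1.2 (i, j) (by simp only [hi, hj])))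
  -- The owner of `t` now knows two `g × g` matrices of factor values; it multiplies them and
  -- returns the entries to the block owners.
  have h5 := h4.route (K := k * c) hR (fun _ (e : (Fin g × Fin g) × Fin m) => μ e.2)
    (fun _ e => ν e.1) (fun _ _ _ _ => ⟨rfl, rfl⟩) (fun _ => hμg) (fun _ => hνm)
    (fun ω e => ∑ b', α e.2 (block rp cp (A ω) e.1.1 b') * β e.2 (block cp cp (B ω) b' e.1.2))
    (fun ω ω' e hv => Finset.sum_congr rfl fun b' _ => by
      have e1 := hv.1.2 ((e.1.1, b'), e.2) rfl
      have e2 := hv.2 ((b', e.1.2), e.2) rfl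
      dsimp only at e1 e2
      rw [e1, e2])
  -- The bilinear algorithm is applied to each pair of blocks and the sums are exchanged; linearity
  -- of `α` and `β` is never needed.
  have hmul : ∀ ω i j, (A ω * B ω) i j = ∑ t, γ (rp i).1 (cp j).1 t *
      ∑ b', α t (block rp cp (A ω) (rp i).2 b') * β t (block cp cp (B ω) b' (cp j).2) := by
    intro ω i j
    rw [← sum_block_mul_block rp cp cp]
    simp only [← hb.sum_eq, Finset.mul_sum]
    exact Finset.sum_comm
  have h6 := h5.route (K := k * c) hR (fun _ (e : Fin s × Fin n) => ν ((rp e.1).2, (cp e.2).2))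
    (fun ω e => holderA ω e.1)
    (fun v ω ω' hv => ⟨rfl, by rw [(hρ v ω ω' hv.1.1.1.1.1).1]⟩)
    (fun _ => hblockA) (fun ω v => (card_filter_fst_le (hA ω) v).trans hnkc)
    (fun ω e => (A ω * B ω) e.1 e.2)
    (fun ω ω' e hv => by
      rw [hmul, hmul]
      refine Finset.sum_congr rfl fun t _ => ?_
      have e1 := hv.2 (((rp e.1).2, (cp e.2).2), t) rfl
      dsimp only at e1
      rw [e1])
  have hT : T + 4 * (k * c) * L + 4 * (k * c) * L + 4 * (k * c) * L + 4 * (k * c) * L +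
      4 * (k * c) * L + 4 * (k * c) * L = T + 24 * (k * c) * L := by ring
  rw [hT] at h6
  exact h6.mono fun v ω ω' hv => ⟨(hρ v ω ω' hv.1.1.1.1.1.1).1,
    fun i hi => funext fun j => hv.2 (i, j) hi⟩

/-! ### Scaling and rounding -/

/-- `⌈a * D / 2 ^ i⌉`. -/
def scaled (D i a : ℕ) : ℕ := (a * D + (2 ^ i - 1)) / 2 ^ i

theorem mul_le_pow_mul_scaled (D i a : ℕ) : a * D ≤ 2 ^ i * scaled D i a := by
  have h := Nat.div_add_mod (a * D + (2 ^ i - 1)) (2 ^ i)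
  have h2 := Nat.mod_lt (a * D + (2 ^ i - 1)) (show 0 < 2 ^ i by positivity)
  unfold scaled
  omega

theorem pow_mul_scaled_le (D i a : ℕ) : 2 ^ i * scaled D i a ≤ a * D + 2 ^ i := by
  have h := Nat.div_mul_le_self (a * D + (2 ^ i - 1)) (2 ^ i)
  rw [mul_comm] at h
  have hp : 0 < 2 ^ i := by positivity
  unfold scaled
  omega

theorem scaled_le {D i a : ℕ} (h : a ≤ 2 ^ i) : scaled D i a ≤ D := by
  have hp : 0 < 2 ^ i := by positivity
  refine Nat.lt_succ_iff.mp ((Nat.div_lt_iff_lt_mul hp).mpr ?_)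
  have : a * D ≤ D * 2 ^ i := by rw [mul_comm]; exact Nat.mul_le_mul_left _ h
  rw [Nat.succ_mul]
  omega

/-- The ring of the scaled entries: for each of `S` scales, a group algebra over `ℤ / (n + 1)`. -/
abbrev ScaleRing (n D S : ℕ) : Type := Fin S → AddMonoidAlgebra (ZMod (n + 1)) (ZMod (2 * D + 1))

noncomputable instance scaleRingFintype (n D S : ℕ) : Fintype (ScaleRing n D S) :=
  haveI : Fintype (AddMonoidAlgebra (ZMod (n + 1)) (ZMod (2 * D + 1))) :=
    Fintype.ofEquiv (ZMod (2 * D + 1) → ZMod (n + 1))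
      (Finsupp.equivFunOnFinite.symm.trans AddMonoidAlgebra.coeffEquiv.symm)
  inferInstance

theorem card_scaleRing (n D S : ℕ) :
    Fintype.card (ScaleRing n D S) = (n + 1) ^ ((2 * D + 1) * S) := by
  rw [← Nat.card_eq_fintype_card, Nat.card_fun, Nat.card_congr
    (AddMonoidAlgebra.coeffEquiv.trans Finsupp.equivFunOnFinite), Nat.card_fun]
  simp [pow_mul]

/-- An entry at all scales: `X ^ ⌈a * D / 2 ^ i⌉` at the scale `i`, and `0` if `a` is too large. -/
noncomputable def encodeEntry (n D S : ℕ) (a : ℕ) : ScaleRing n D S :=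
  fun i => if a ≤ 2 ^ (i : ℕ) then AddMonoidAlgebra.single (scaled D i a : ZMod (2 * D + 1)) 1
    else 0

/-- The least of the values rescaled from the exponents that occur. -/
noncomputable def decodeEntry {n D S : ℕ} (w : ScaleRing n D S) : ℕ :=
  sInf {y | ∃ i : Fin S, ∃ d ≤ 2 * D, (w i).coeff (d : ZMod (2 * D + 1)) ≠ 0 ∧
    y = 2 ^ (i : ℕ) * d / D}

section Scales

variable {n s : ℕ} (D S : ℕ) (A : Matrix (Fin s) (Fin n) ℕ) (B : Matrix (Fin n) (Fin n) ℕ)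

/-- Multiplying monomials adds exponents, so each `k` whose two entries survive at the scale
contributes `1` to one coefficient. -/
theorem coeff_encode_mul (i : Fin S) (d : ZMod (2 * D + 1)) (r : Fin s) (j : Fin n) :
    ((A.map (encodeEntry n D S) * B.map (encodeEntry n D S)) r j i).coeff d =
      ((Finset.univ.filter fun k => A r k ≤ 2 ^ (i : ℕ) ∧ B k j ≤ 2 ^ (i : ℕ) ∧
        ((scaled D i (A r k) + scaled D i (B k j) : ℕ) : ZMod (2 * D + 1)) = d).card :
          ZMod (n + 1)) := by
  classical
  rw [Matrix.mul_apply, Finset.sum_apply, AddMonoidAlgebra.coeff_sum, Finsupp.finsetSum_apply,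
    Finset.card_filter, Nat.cast_sum]
  refine Finset.sum_congr rfl fun k _ => ?_
  simp only [Matrix.map_apply, Pi.mul_apply, encodeEntry]
  by_cases h1 : A r k ≤ 2 ^ (i : ℕ) <;> by_cases h2 : B k j ≤ 2 ^ (i : ℕ) <;>
    simp [h1, h2, AddMonoidAlgebra.single_mul_single, Finsupp.single_apply]

/-- The moduli are just large enough: a count is at most `n`, so it cannot vanish modulo `n + 1`,
and a sum of exponents is at most `2 * D`, so it cannot wrap around modulo `2 * D + 1`. -/
theorem coeff_encode_mul_ne_zero (i : Fin S) {d : ℕ} (hd : d ≤ 2 * D) (r : Fin s) (j : Fin n) :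
    ((A.map (encodeEntry n D S) * B.map (encodeEntry n D S)) r j i).coeff
        (d : ZMod (2 * D + 1)) ≠ 0 ↔
      ∃ k, A r k ≤ 2 ^ (i : ℕ) ∧ B k j ≤ 2 ^ (i : ℕ) ∧
        scaled D i (A r k) + scaled D i (B k j) = d := by
  rw [coeff_encode_mul, Ne, ZMod.natCast_eq_zero_iff]
  have hcard := Finset.card_le_univ (Finset.univ.filter fun k => A r k ≤ 2 ^ (i : ℕ) ∧
    B k j ≤ 2 ^ (i : ℕ) ∧
    ((scaled D i (A r k) + scaled D i (B k j) : ℕ) : ZMod (2 * D + 1)) = d)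
  rw [Fintype.card_fin] at hcard
  constructor
  · intro h
    obtain ⟨k, hk⟩ := Finset.card_pos.mp (Nat.pos_of_ne_zero fun h0 => h (h0 ▸ dvd_zero _))
    obtain ⟨-, h1, h2, h3⟩ := Finset.mem_filter.mp hk
    refine ⟨k, h1, h2, ?_⟩
    have h4 := scaled_le (D := D) h1
    have h5 := scaled_le (D := D) h2
    rw [ZMod.natCast_eq_natCast_iff'] at h3
    rwa [Nat.mod_eq_of_lt (by omega), Nat.mod_eq_of_lt (by omega)] at h3
  · rintro ⟨k, h1, h2, h3⟩ hdvd
    have hpos := Finset.card_pos.mpr ⟨k, Finset.mem_filter (p := fun k =>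
      A r k ≤ 2 ^ (i : ℕ) ∧ B k j ≤ 2 ^ (i : ℕ) ∧
        ((scaled D i (A r k) + scaled D i (B k j) : ℕ) : ZMod (2 * D + 1)) = d).mpr
      ⟨Finset.mem_univ k, h1, h2, congrArg (Nat.cast : ℕ → ZMod (2 * D + 1)) h3⟩⟩
    have := Nat.le_of_dvd hpos hdvd
    omega

/-- Zwick's approximation of the min-plus product by a ring product. -/
theorem isApproximation_decodeEntry {M : ℕ} {R : ℝ} (hn : 0 < n) (hR : 1 ≤ R) (hD : 4 * R ≤ D)
    (hS : Nat.clog 2 (2 * M) < S) (hA : ∀ i k, 1 ≤ A i k ∧ A i k ≤ M)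
    (hB : ∀ k j, 1 ≤ B k j ∧ B k j ≤ M) :
    IsApproximation (1 + 1 / R) (minPlus A B)
      (fun r j => decodeEntry ((A.map (encodeEntry n D S) * B.map (encodeEntry n D S)) r j)) := by
  intro r j
  have hDpos : 0 < D := by
    have : (0 : ℝ) < D := by linarith
    exact_mod_cast this
  have hne : Nonempty (Fin n) := ⟨⟨0, hn⟩⟩
  obtain ⟨k, hk⟩ := Nat.sInf_mem (Set.range_nonempty fun k => A r k + B k j)
  change A r k + B k j = minPlus A B r j at hk
  have hCk : ∀ k, minPlus A B r j ≤ A r k + B k j := fun k => Nat.sInf_le ⟨k, rfl⟩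
  set c := minPlus A B r j with hc
  have hc2 : 2 ≤ c := by have := (hA r k).1; have := (hB k j).1; omega
  have hcM : c ≤ 2 * M := by have := (hA r k).2; have := (hB k j).2; omega
  -- The scale with `c ≤ 2 ^ i ≤ 2 * c`: both summands of the minimum survive, and the two roundings
  -- add at most `2 * 2 ^ i ≤ 4 * c` before division by `D`.
  let i : Fin S := ⟨Nat.clog 2 c, lt_of_le_of_lt (Nat.clog_mono_right 2 hcM) hS⟩
  have hci : c ≤ 2 ^ (i : ℕ) := Nat.le_pow_clog one_lt_two c
  have hic : 2 ^ (i : ℕ) ≤ 2 * c := by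
    have h1 := Nat.pow_pred_clog_lt_self one_lt_two (show 1 < c by omega)
    have h2 : 0 < Nat.clog 2 c := Nat.clog_pos one_lt_two hc2
    have h3 : 2 ^ (i : ℕ) = 2 * 2 ^ (Nat.clog 2 c).pred := by
      rw [← pow_succ', ← Nat.succ_eq_add_one, Nat.succ_pred_eq_of_pos h2]
    omega
  have h1 : A r k ≤ 2 ^ (i : ℕ) := by omega
  have h2 : B k j ≤ 2 ^ (i : ℕ) := by omega
  have hmem : 2 ^ (i : ℕ) * (scaled D i (A r k) + scaled D i (B k j)) / D ∈
      {y | ∃ i : Fin S, ∃ d ≤ 2 * D,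
        ((A.map (encodeEntry n D S) * B.map (encodeEntry n D S)) r j i).coeff
          (d : ZMod (2 * D + 1)) ≠ 0 ∧ y = 2 ^ (i : ℕ) * d / D} := by
    have h3 := scaled_le (D := D) h1
    have h4 := scaled_le (D := D) h2
    exact ⟨i, _, by omega, (coeff_encode_mul_ne_zero D S A B i (by omega) r j).mpr
      ⟨k, h1, h2, rfl⟩, rfl⟩
  constructor
  · obtain ⟨i', d, hd, hcoeff, hy⟩ := Nat.sInf_mem ⟨_, hmem⟩
    obtain ⟨k', -, -, hk'⟩ := (coeff_encode_mul_ne_zero D S A B i' hd r j).mp hcoeff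
    rw [Nat.cast_le]
    change c ≤ sInf _
    rw [hy, Nat.le_div_iff_mul_le hDpos, ← hk', mul_add]
    have h3 := mul_le_pow_mul_scaled D i' (A r k')
    have h4 := mul_le_pow_mul_scaled D i' (B k' j)
    have h5 := Nat.mul_le_mul_right D (hCk k')
    rw [add_mul] at h5
    omega
  · have hle : decodeEntry ((A.map (encodeEntry n D S) * B.map (encodeEntry n D S)) r j) ≤
        2 ^ (i : ℕ) * (scaled D i (A r k) + scaled D i (B k j)) / D := Nat.sInf_le hmem
    have h3 := pow_mul_scaled_le D i (A r k)
    have h4 := pow_mul_scaled_le D i (B k j)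
    have h5 : decodeEntry ((A.map (encodeEntry n D S) * B.map (encodeEntry n D S)) r j) * D ≤
        c * D + 4 * c := by
      refine (Nat.mul_le_mul_right D hle).trans ((Nat.div_mul_le_self _ _).trans ?_)
      rw [mul_add, ← hk, add_mul]
      omega
    beta_reduce
    generalize decodeEntry ((A.map (encodeEntry n D S) * B.map (encodeEntry n D S)) r j) = y at h5 ⊢
    have h6 : (y : ℝ) * D ≤ c * D + 4 * c := by exact_mod_cast h5
    have hD0 : (0 : ℝ) < D := by exact_mod_cast hDpos
    have hR0 : 0 < R := by linarith
    have h7 : (4 : ℝ) ≤ D * (1 / R) := by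
      rw [mul_one_div, le_div_iff₀ hR0]; exact hD
    have h8 : (c : ℝ) * 4 ≤ c * (D * (1 / R)) := by gcongr
    refine le_of_mul_le_mul_right ?_ hD0
    calc (y : ℝ) * D ≤ c * D + c * 4 := by linarith
      _ ≤ c * D + c * (D * (1 / R)) := by linarith
      _ = (1 + 1 / R) * c * D := by ring

end Scales

/-! ### The algorithm -/

/-- The matrices and the assignments of their rows to the vertices. -/
abbrev Configuration (s n : ℕ) : Type :=
  ((Fin s ↪ Fin n) × (Fin n ≃ Fin n)) × Matrix (Fin s) (Fin n) ℕ × Matrix (Fin n) (Fin n) ℕ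

/-- The local inputs of all vertices. -/
def Configuration.input {s n : ℕ} (ω : Configuration s n) (v : Fin n) : LocalInput s n :=
  (heldRows ω.1.1 ω.2.1 v, heldRows ω.1.2 ω.2.2 v)

section HeldRows

variable {p n : ℕ} {h h' : Fin p → Fin n} {X X' : Matrix (Fin p) (Fin n) ℕ} {v : Fin n}

theorem heldRows_eq_holder (e : heldRows h X v = heldRows h' X' v) (i : Fin p) :
    h i = v ↔ h' i = v := by
  have := congrFun e i
  unfold heldRows at this
  split_ifs at this with h1 h2 h2 <;> simp_all

theorem heldRows_eq_row (e : heldRows h X v = heldRows h' X' v) (i : Fin p) (hi : h i = v) :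
    X i = X' i := by
  have h2 := (heldRows_eq_holder e i).mp hi
  have := congrFun e i
  simpa [heldRows, hi, h2] using this

theorem partialInv_eq_of_heldRows_eq (hh : Function.Injective h) (hh' : Function.Injective h')
    (e : heldRows h X v = heldRows h' X' v) :
    Function.partialInv h v = Function.partialInv h' v := by
  ext i
  rw [hh.isPartialInv,
    hh'.isPartialInv]
  exact heldRows_eq_holder e i

end HeldRows

theorem eq_of_partialInv_eq {p n : ℕ} {h h' : Fin p → Fin n} (hh : Function.Injective h)
    (hh' : Function.Injective h')
    (e : ∀ v, Function.partialInv h v = Function.partialInv h' v) : h = h' := by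
  funext i
  rw [eq_comm, ← hh'.isPartialInv, ← e, hh.isPartialInv]

/-- A vertex finds its row of `A` through the partial inverse of the assignment; one without a row
outputs zero. -/
theorem Learns.exists_rowOutputs {s n T : ℕ} (rowOut : Configuration s n → Matrix (Fin s) (Fin n) ℕ)
    (h : Learns (Configuration.input (s := s) (n := n)) T fun v ω ω' => ⇑ω.1.1 = ⇑ω'.1.1 ∧
      ∀ i, ω.1.1 i = v → rowOut ω i = rowOut ω' i) :
    ∃ alg : CCAlgorithm n (LocalInput s n) (Fin n → ℕ), ∀ (ω : Configuration s n) i,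
      alg.outputs ω.input T (ω.1.1 i) = rowOut ω i := by
  let out : Configuration s n → Fin n → Fin n → ℕ := fun ω v =>
    (Function.partialInv ω.1.1 v).elim 0 fun i => rowOut ω i
  obtain ⟨alg, halg⟩ := h.exists_outputs out (by
    rintro v ω ω' ⟨h1, h2⟩
    simp only [out, ← h1]
    rcases hi : Function.partialInv ω.1.1 v with _ | i
    · rfl
    · exact h2 i ((ω.1.1.injective.isPartialInv _ _).mp hi))
  refine ⟨alg, fun ω i => ?_⟩
  rw [halg]
  simp only [out, (ω.1.1.injective.isPartialInv _ _).mpr rfl,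
    Option.elim_some]

/-- All vertices learn which vertex holds which row. -/
theorem learns_holders {s n : ℕ} (hn : 2 ≤ n) (hs : s ≤ n) :
    Learns (Configuration.input (s := s) (n := n)) 4 fun v ω ω' => ω.1 = ω'.1 ∧
      (∀ i, ω.1.1 i = v → ω.2.1 i = ω'.2.1 i) ∧ ∀ i, ω.1.2 i = v → ω.2.2 i = ω'.2.2 i := by
  -- Every vertex broadcasts the indices of its rows. Four messages hold such a pair, as `n + 1 ≤ n
  -- ^ 2` for `n ≥ 2`.
  have hcard : Fintype.card (Option (Fin s) × Option (Fin n)) ≤ 2 ^ (Nat.clog 2 n * 4) := by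
    simp only [Fintype.card_prod, Fintype.card_option, Fintype.card_fin]
    have h1 := Nat.le_pow_clog one_lt_two n
    calc (s + 1) * (n + 1) ≤ (n * n) * (n * n) := by
          refine Nat.mul_le_mul ?_ ?_ <;> nlinarith
      _ = n ^ 4 := by ring
      _ ≤ (2 ^ Nat.clog 2 n) ^ 4 := Nat.pow_le_pow_left h1 4
      _ = _ := by rw [← pow_mul]
  have h := (learns_input (Configuration.input (s := s) (n := n))).exchange hcard
    (fun ω v _ => (Function.partialInv ω.1.1 v, Function.partialInv ω.1.2 v))
    (fun v ω ω' e => by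
      rw [partialInv_eq_of_heldRows_eq ω.1.1.injective ω'.1.1.injective (Prod.mk.inj e).1,
        partialInv_eq_of_heldRows_eq ω.1.2.injective ω'.1.2.injective (Prod.mk.inj e).2])
  rw [zero_add] at h
  refine h.mono ?_
  rintro v ω ω' ⟨e, h⟩
  refine ⟨Prod.ext ?_ ?_, heldRows_eq_row (Prod.mk.inj e).1, heldRows_eq_row (Prod.mk.inj e).2⟩
  · exact DFunLike.coe_injective (eq_of_partialInv_eq ω.1.1.injective ω'.1.1.injective
      fun u => (Prod.mk.inj (h u)).1)
  · exact DFunLike.coe_injective (eq_of_partialInv_eq ω.1.2.injective ω'.1.2.injective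
      fun u => (Prod.mk.inj (h u)).2)

/-- The round count for given parameters of the block decomposition. -/
theorem exists_approxMinPlus_algorithm {s n M D S : ℕ} {R : ℝ} (hn : 2 ≤ n) (hsn : s ≤ n)
    (hR : 1 ≤ R) (hD : 4 * R ≤ D) (hS : Nat.clog 2 (2 * M) < S)
    {p q g m k c : ℕ} (hs : s ≤ p * g) (hq' : n ≤ q * g) (hp : p * q ≤ n) (hq : q * q ≤ n)
    (hg : g * g ≤ n * k) (hm : m ≤ n * c) (hk : 1 ≤ k) (hc : 1 ≤ c)
    {α : Fin m → Matrix (Fin p) (Fin q) (ScaleRing n D S) → ScaleRing n D S}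
    {β : Fin m → Matrix (Fin q) (Fin q) (ScaleRing n D S) → ScaleRing n D S}
    {γ : Fin p → Fin q → Fin m → ScaleRing n D S} (hb : IsBilinearAlgorithm α β γ) :
    ∃ alg : CCAlgorithm n (LocalInput s n) (Fin n → ℕ),
      ∀ (holderA : Fin s ↪ Fin n) (holderB : Fin n ≃ Fin n)
        (A : Matrix (Fin s) (Fin n) ℕ) (B : Matrix (Fin n) (Fin n) ℕ),
        (∀ i k, 1 ≤ A i k ∧ A i k ≤ M) → (∀ k j, 1 ≤ B k j ∧ B k j ≤ M) →
        IsApproximation (1 + 1 / R) (minPlus A B)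
          (fun i => alg.outputs (fun v => (heldRows holderA A v, heldRows holderB B v))
            (4 + 24 * (k * c) * (2 * ((2 * D + 1) * S))) (holderA i)) := by
  have hcard : Fintype.card (ScaleRing n D S) ≤
      2 ^ (Nat.clog 2 n * (2 * ((2 * D + 1) * S))) := by
    rw [card_scaleRing, ← mul_assoc, pow_mul _ (Nat.clog 2 n * 2)]
    refine Nat.pow_le_pow_left ?_ _
    calc n + 1 ≤ n ^ 2 := by nlinarith
      _ ≤ (2 ^ Nat.clog 2 n) ^ 2 := Nat.pow_le_pow_left (Nat.le_pow_clog one_lt_two n) 2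
      _ = _ := by rw [← pow_mul]
  have h := (learns_holders hn hsn).matrix_mul hcard
    (holderA := fun ω => ω.1.1) (fun ω => ω.1.1.injective)
    (holderB := fun ω => ω.1.2) (fun ω => ω.1.2.injective)
    (A := fun ω => ω.2.1.map (encodeEntry n D S)) (B := fun ω => ω.2.2.map (encodeEntry n D S))
    (fun v ω ω' hv => ⟨by rw [hv.1], by rw [hv.1],
      fun i hi => funext fun j => congrArg (encodeEntry n D S) (congrFun (hv.2.1 i hi) j),
      fun i hi => funext fun j => congrArg (encodeEntry n D S) (congrFun (hv.2.2 i hi) j)⟩)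
    hs hq' hp hq hg hm hk hc hb
  obtain ⟨alg, halg⟩ := Learns.exists_rowOutputs
    (fun ω i j => decodeEntry ((ω.2.1.map (encodeEntry n D S) *
      ω.2.2.map (encodeEntry n D S)) i j))
    (h.mono fun v ω ω' hv => ⟨hv.1, fun i hi => funext fun j =>
      congrArg decodeEntry (congrFun (hv.2 i hi) j)⟩)
  refine ⟨alg, fun holderA holderB A B hA hB => ?_⟩
  have h2 := isApproximation_decodeEntry D S A B (by omega) hR hD hS hA hB
  have h3 : (fun i => alg.outputs (fun v => (heldRows holderA A v, heldRows holderB B v))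
      (4 + 24 * (k * c) * (2 * ((2 * D + 1) * S))) (holderA i)) = _ :=
    funext fun i => halg ((holderA, holderB), (A, B)) i
  rw [h3]
  exact h2

/-- A single vertex knows both matrices. -/
theorem exists_minPlus_algorithm_one (s : ℕ) :
    ∃ alg : CCAlgorithm 1 (LocalInput s 1) (Fin 1 → ℕ),
      ∀ (holderA : Fin s ↪ Fin 1) (holderB : Fin 1 ≃ Fin 1)
        (A : Matrix (Fin s) (Fin 1) ℕ) (B : Matrix (Fin 1) (Fin 1) ℕ),
        (fun i => alg.outputs (fun v => (heldRows holderA A v, heldRows holderB B v)) 0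
          (holderA i)) = minPlus A B := by
  obtain ⟨alg, halg⟩ := Learns.exists_rowOutputs (s := s) (n := 1)
    (fun ω => minPlus ω.2.1 ω.2.2)
    ((learns_input _).mono fun v ω ω' e => by
      have hA : ω.2.1 = ω'.2.1 := funext fun i =>
        heldRows_eq_row (Prod.mk.inj e).1 i (Subsingleton.elim _ _)
      have hB : ω.2.2 = ω'.2.2 := funext fun i =>
        heldRows_eq_row (Prod.mk.inj e).2 i (Subsingleton.elim _ _)
      exact ⟨funext fun i => Subsingleton.elim _ _, fun i _ => by rw [hA, hB]⟩)
  exact ⟨alg, fun holderA holderB A B =>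
    funext fun i => halg ((holderA, holderB), (A, B)) i⟩

theorem isApproximation_refl {s n : ℕ} {δ : ℝ} (hδ : 1 ≤ δ) (C : Matrix (Fin s) (Fin n) ℕ) :
    IsApproximation δ C C :=
  fun _ _ => ⟨le_rfl, le_mul_of_one_le_left (Nat.cast_nonneg _) hδ⟩

theorem minPlus_of_entries_one {s n : ℕ} (hn : 0 < n) {A : Matrix (Fin s) (Fin n) ℕ}
    {B : Matrix (Fin n) (Fin n) ℕ} (hA : ∀ i k, 1 ≤ A i k ∧ A i k ≤ 1)
    (hB : ∀ k j, 1 ≤ B k j ∧ B k j ≤ 1) : minPlus A B = fun _ _ => 2 := by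
  have : Nonempty (Fin n) := ⟨⟨0, hn⟩⟩
  funext i j
  have h1 : ∀ k, A i k + B k j = 2 := fun k => by
    have := hA i k
    have := hB k j
    omega
  simp only [minPlus, h1, ciInf_const]

/-! ### The number of rounds -/

/-- The side of the blocks. -/
theorem exists_block_parameters {r r' σ : ℝ} (hr' : r' ≤ 1) (hσ : 2 ≤ σ)
    (hbal : 1 - r' ≤ (1 - r) * σ) {n s : ℕ} (hn : 1 ≤ n) (hr0 : 0 ≤ r)
    (hs : s ≤ ⌈(n : ℝ) ^ r⌉₊) :
    ∃ q g k : ℕ, 1 ≤ q ∧ 1 ≤ k ∧ s ≤ ⌈(q : ℝ) ^ r'⌉₊ * g ∧ n ≤ q * g ∧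
      ⌈(q : ℝ) ^ r'⌉₊ * q ≤ n ∧ q * q ≤ n ∧ g * g ≤ n * k ∧ (q : ℝ) ^ σ ≤ n ∧
      (k : ℝ) ≤ 26 * (n : ℝ) ^ (1 - 2 / σ) := by
  have hn1 : (1 : ℝ) ≤ n := by exact_mod_cast hn
  have hn0 : (0 : ℝ) < n := by linarith
  have hσ0 : 0 < σ := by linarith
  have hinv : 0 < 1 / σ := by positivity
  have hinv2 : 1 / σ ≤ 1 / 2 := one_div_le_one_div_of_le two_pos hσ
  set x : ℝ := (n : ℝ) ^ (1 / σ) with hx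
  have hx1 : 1 ≤ x := Real.one_le_rpow hn1 hinv.le
  have hx0 : 0 < x := by linarith
  -- The largest `q` with `q ^ σ ≤ n`, so that the number of products is linear in `n`.
  set q : ℕ := ⌊x⌋₊ with hq
  have hq1 : 1 ≤ q := Nat.le_floor (by exact_mod_cast hx1)
  have hq1' : (1 : ℝ) ≤ q := by exact_mod_cast hq1
  have hq0 : (0 : ℝ) < q := by linarith
  have hqx : (q : ℝ) ≤ x := Nat.floor_le hx0.le
  have hxq : x ≤ 2 * q := by have := Nat.lt_floor_add_one x; linarith
  have hxσ : x ^ σ = n := by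
    rw [hx, ← Real.rpow_mul hn0.le, one_div_mul_cancel hσ0.ne', Real.rpow_one]
  have hqσ : (q : ℝ) ^ σ ≤ n := hxσ ▸ Real.rpow_le_rpow hq0.le hqx hσ0.le
  have hqq : q * q ≤ n := by
    have h1 : (q : ℝ) ^ (2 : ℝ) ≤ (q : ℝ) ^ σ := Real.rpow_le_rpow_of_exponent_le hq1' hσ
    rw [show (2 : ℝ) = ((2 : ℕ) : ℝ) by norm_num, Real.rpow_natCast, sq] at h1
    exact_mod_cast h1.trans hqσ
  set p : ℕ := ⌈(q : ℝ) ^ r'⌉₊ with hp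
  have hpq : p ≤ q := by
    rw [hp, Nat.ceil_le]
    calc (q : ℝ) ^ r' ≤ (q : ℝ) ^ (1 : ℝ) := Real.rpow_le_rpow_of_exponent_le hq1' hr'
      _ = q := Real.rpow_one _
  have hp0 : (0 : ℝ) < p := by
    exact_mod_cast Nat.ceil_pos.mpr (by positivity)
  have hpx : x ^ r' ≤ 2 * p := by
    refine le_trans ?_ (mul_le_mul_of_nonneg_left (Nat.le_ceil _) zero_le_two)
    -- The solution `r'` may be negative; the power then reverses the inequality `q ≤ x`, which only
    -- helps.
    rcases le_total 0 r' with h | h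
    · calc x ^ r' ≤ (2 * q : ℝ) ^ r' := Real.rpow_le_rpow hx0.le hxq h
        _ = 2 ^ r' * (q : ℝ) ^ r' := Real.mul_rpow zero_le_two hq0.le
        _ ≤ 2 ^ (1 : ℝ) * (q : ℝ) ^ r' := by
            gcongr
            · norm_num
        _ = _ := by rw [Real.rpow_one]
    · have h1 : x ^ r' ≤ (q : ℝ) ^ r' := Real.rpow_le_rpow_of_nonpos hq0 hqx h
      have h2 : (0 : ℝ) < (q : ℝ) ^ r' := by positivity
      linarith
  set y : ℝ := (n : ℝ) ^ (1 - 1 / σ) with hy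
  have hy1 : 1 ≤ y := Real.one_le_rpow hn1 (by linarith)
  have hxy : x * y = n := by
    rw [hx, hy, ← Real.rpow_add hn0, add_sub_cancel, Real.rpow_one]
  have hnr1 : (1 : ℝ) ≤ (n : ℝ) ^ r := Real.one_le_rpow hn1 hr0
  have hsy : (s : ℝ) ≤ 2 * (x ^ r' * y) := by
    have h1 : (s : ℝ) ≤ 2 * (n : ℝ) ^ r :=
      (Nat.cast_le.mpr hs).trans (natCeil_le_two_mul hnr1)
    -- The balance condition says `r ≤ r' / σ + 1 - 1 / σ`: blocks of side `g ≈ y` serve the rows of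
    -- `A` as well as those of `B`.
    have h2 : (n : ℝ) ^ r ≤ x ^ r' * y := by
      rw [hx, hy, ← Real.rpow_mul hn0.le, ← Real.rpow_add hn0]
      refine Real.rpow_le_rpow_of_exponent_le hn1 ?_
      have h3 : (1 - r') * (1 / σ) ≤ (1 - r) * σ * (1 / σ) :=
        mul_le_mul_of_nonneg_right hbal hinv.le
      have h4 : (1 - r) * σ * (1 / σ) = 1 - r := by field_simp
      linarith
    linarith
  have hg1 : ((s / p + 1 : ℕ) : ℝ) ≤ 5 * y := by
    have h1 : ((s / p : ℕ) : ℝ) ≤ s / p := Nat.cast_div_le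
    have h2 : (s : ℝ) / p ≤ 4 * y := by
      rw [div_le_iff₀ hp0]
      have : x ^ r' * y ≤ 2 * p * y := by gcongr
      linarith
    push_cast
    linarith
  have hg2 : ((n / q + 1 : ℕ) : ℝ) ≤ 5 * y := by
    have h1 : ((n / q : ℕ) : ℝ) ≤ n / q := Nat.cast_div_le
    have h2 : (n : ℝ) / q ≤ 2 * y := by
      rw [div_le_iff₀ hq0, ← hxy]
      have : x * y ≤ 2 * q * y := by gcongr
      linarith
    push_cast
    linarith
  have hp0' : 0 < p := by exact_mod_cast hp0
  obtain ⟨g, hgs, hgn, hg⟩ : ∃ g : ℕ, s / p + 1 ≤ g ∧ n / q + 1 ≤ g ∧ (g : ℝ) ≤ 5 * y := by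
    refine ⟨max (s / p + 1) (n / q + 1), le_max_left _ _, le_max_right _ _, ?_⟩
    rw [Nat.cast_max]
    exact max_le hg1 hg2
  refine ⟨q, g, g * g / n + 1, hq1, Nat.le_add_left _ _, ?_, ?_, ?_, hqq, ?_, hqσ, ?_⟩
  · exact (Nat.lt_mul_div_succ s hp0').le.trans (Nat.mul_le_mul_left _ hgs)
  · exact (Nat.lt_mul_div_succ n hq1).le.trans (Nat.mul_le_mul_left _ hgn)
  · exact (Nat.mul_le_mul_right _ hpq).trans hqq
  · exact (Nat.lt_mul_div_succ (g * g) hn).le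
  · have h1 : ((g * g / n : ℕ) : ℝ) ≤ ((g * g : ℕ) : ℝ) / n := Nat.cast_div_le
    have hyy : y * y = (n : ℝ) ^ (1 - 2 / σ) * n := by
      rw [hy, ← Real.rpow_add hn0, ← Real.rpow_add_one hn0.ne']
      congr 1
      ring
    have h2 : ((g * g : ℕ) : ℝ) / n ≤ 25 * (n : ℝ) ^ (1 - 2 / σ) := by
      rw [div_le_iff₀ hn0]
      push_cast
      have : (g : ℝ) * g ≤ (5 * y) * (5 * y) := by gcongr
      nlinarith
    have h3 : (1 : ℝ) ≤ (n : ℝ) ^ (1 - 2 / σ) := by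
      refine Real.one_le_rpow hn1 ?_
      have : 2 / σ = 2 * (1 / σ) := by ring
      linarith
    push_cast at h1 h2 ⊢
    linarith

theorem clog_two_mul_succ_le {M : ℕ} (hM : 2 ≤ M) :
    ((Nat.clog 2 (2 * M) + 1 : ℕ) : ℝ) ≤ 8 * Real.log M := by
  have hM' : (2 : ℝ) ≤ M := by exact_mod_cast hM
  have hlog2 := Real.log_two_gt_d9
  have hlogM : Real.log 2 ≤ Real.log M := Real.log_le_log two_pos hM'
  have h1 := Nat.pow_pred_clog_lt_self one_lt_two (show 1 < 2 * M by omega)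
  have h2 : 0 < Nat.clog 2 (2 * M) := Nat.clog_pos one_lt_two (by omega)
  obtain ⟨l, hl⟩ : ∃ l, Nat.clog 2 (2 * M) = l + 1 := ⟨_, (Nat.succ_pred_eq_of_pos h2).symm⟩
  rw [hl, Nat.pred_succ] at h1
  have h3 : (2 : ℝ) ^ l ≤ 2 * M := by exact_mod_cast h1.le
  have h4 := Real.log_le_log (by positivity) h3
  rw [Real.log_pow, Real.log_mul two_ne_zero (by linarith)] at h4
  rw [hl]
  push_cast
  nlinarith

/-- The balance is only an inequality, so that `σ` may exceed the exponent at `r'` while `r'` stays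
fixed. -/
theorem approxMinPlusInRounds_of_hasMMExponent {r r' σ : ℝ} (hr0 : 0 < r) (hr1 : r ≤ 1)
    (hr' : r' ≤ 1) (hbal : 1 - r' ≤ (1 - r) * σ) (h : HasMMExponent r' σ) :
    ApproxMinPlusInRounds r (1 - 2 / σ) := by
  have hσ := h.two_le
  obtain ⟨C, hC⟩ := h.exists_isBilinearAlgorithm
  -- Here `24` comes from the six routings, `26` bounds `k`, and `272 = 2 * 17 * 8` bounds the
  -- length of a ring element. The `8` pays for the four initial rounds, since `1 / 2 ≤ log M` for
  -- `M ≥ 2`.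
  refine ⟨8 + 24 * 26 * 272 * (C + 1), fun n s M R hs hM hR => ?_⟩
  have hR0 : 0 < R := by linarith
  have hM1 : (1 : ℝ) ≤ M := by exact_mod_cast hM
  have hlogM : 0 ≤ Real.log M := Real.log_nonneg hM1
  have hbound : (0 : ℝ) ≤ (8 + 24 * 26 * 272 * (C + 1)) *
      (R * (n : ℝ) ^ (1 - 2 / σ) * Real.log M) := by positivity
  have hδ : 1 ≤ 1 + 1 / R := by
    have : 0 < 1 / R := by positivity
    linarith
  rcases Nat.eq_zero_or_pos n with rfl | hn
  · rw [Nat.cast_zero, Real.zero_rpow hr0.ne', Nat.ceil_zero, Nat.le_zero] at hs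
    subst hs
    exact ⟨⟨Unit, fun _ _ => (), fun _ _ _ _ => false, fun _ _ _ => (), fun _ _ _ => 2⟩, 0,
      by exact_mod_cast hbound, fun _ _ _ _ _ _ i => i.elim0⟩
  -- For `M = 1` the bound is zero rounds, but every entry of the product is `2`.
  rcases hM.eq_or_lt with rfl | hM2
  · refine ⟨⟨Unit, fun _ _ => (), fun _ _ _ _ => false, fun _ _ _ => (), fun _ _ _ => 2⟩, 0,
      by rwa [Nat.cast_zero], fun _ _ A B hA hB => ?_⟩
    rw [minPlus_of_entries_one hn hA hB]
    exact isApproximation_refl hδ _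
  -- For `n = 1` messages have no bits, and none are needed.
  rcases (Nat.succ_le_iff.mpr hn).eq_or_lt with rfl | hn2
  · obtain ⟨alg, halg⟩ := exists_minPlus_algorithm_one s
    refine ⟨alg, 0, by rwa [Nat.cast_zero], fun hA hB A B _ _ => ?_⟩
    rw [halg]
    exact isApproximation_refl hδ _
  obtain ⟨q, g, k, hq1, hk, hsg, hng, hpq, hqq, hgk, hqσ, hkn⟩ :=
    exists_block_parameters hr' hσ hbal hn hr0.le hs
  have hn1 : (1 : ℝ) ≤ n := by exact_mod_cast hn
  have hsn : s ≤ n := by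
    refine hs.trans (Nat.ceil_le.mpr ?_)
    calc (n : ℝ) ^ r ≤ (n : ℝ) ^ (1 : ℝ) := Real.rpow_le_rpow_of_exponent_le hn1 hr1
      _ = n := Real.rpow_one _
  let D : ℕ := 4 * ⌈R⌉₊
  let S : ℕ := Nat.clog 2 (2 * M) + 1
  have hD : 4 * R ≤ D := by
    have := Nat.le_ceil R
    simp only [D]
    push_cast
    linarith
  have hD2 : (2 * D + 1 : ℝ) ≤ 17 * R := by
    have := natCeil_le_two_mul hR
    simp only [D]
    push_cast
    linarith
  obtain ⟨m, hm, α, β, γ, hb⟩ := hC q hq1 (ScaleRing n D S)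
  have hmn : m ≤ n * (C + 1) := by
    have h1 : (m : ℝ) ≤ C * n := hm.trans (by gcongr)
    have h2 : m ≤ C * n := by exact_mod_cast h1
    nlinarith
  obtain ⟨alg, halg⟩ := exists_approxMinPlus_algorithm (S := S) hn2 hsn hR hD (Nat.lt_succ_self _)
    hsg hng hpq hqq hgk hmn hk (Nat.succ_le_succ (Nat.zero_le C)) hb
  refine ⟨alg, _, ?_, halg⟩
  have hS : (S : ℝ) ≤ 8 * Real.log M := clog_two_mul_succ_le hM2
  have hL : ((2 * D + 1) * S : ℝ) ≤ (17 * R) * (8 * Real.log M) := by gcongr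
  set e : ℝ := (n : ℝ) ^ (1 - 2 / σ) with he
  have he1 : 1 ≤ e := by
    refine Real.one_le_rpow hn1 ?_
    rw [sub_nonneg, div_le_one (by linarith)]
    exact hσ
  have hlog : 1 ≤ 2 * Real.log M := by
    have h1 := Real.log_two_gt_d9
    have h2 : Real.log 2 ≤ Real.log M := Real.log_le_log two_pos (by exact_mod_cast hM2)
    linarith
  have h4 : (4 : ℝ) ≤ 8 * (R * e * Real.log M) := by
    have h1 : 1 ≤ R * e := one_le_mul_of_one_le_of_one_le hR he1
    nlinarith
  have hmain : (24 * (k * (C + 1)) * (2 * ((2 * D + 1) * S)) : ℝ) ≤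
      24 * (26 * e * (C + 1)) * (2 * ((17 * R) * (8 * Real.log M))) := by
    gcongr
  push_cast
  calc (4 + 24 * (k * (C + 1)) * (2 * ((2 * D + 1) * S)) : ℝ)
      ≤ 8 * (R * e * Real.log M) +
        24 * (26 * e * (C + 1)) * (2 * ((17 * R) * (8 * Real.log M))) := add_le_add h4 hmain
    _ = _ := by ring

/-- Powers of `n` are monotone in the exponent only for `n ≥ 1`; for `n = 0` the matrix `A` has no
rows because `0 < r`. -/
theorem ApproxMinPlusInRounds.mono {r e e' : ℝ} (he : e ≤ e') (hr0 : 0 < r)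
    (h : ApproxMinPlusInRounds r e) : ApproxMinPlusInRounds r e' := by
  obtain ⟨C, hC⟩ := h
  refine ⟨max C 0, fun n s M R hs hM hR => ?_⟩
  have hM1 : (1 : ℝ) ≤ M := by exact_mod_cast hM
  have hlogM : 0 ≤ Real.log M := Real.log_nonneg hM1
  rcases Nat.eq_zero_or_pos n with rfl | hn
  · rw [Nat.cast_zero, Real.zero_rpow hr0.ne', Nat.ceil_zero, Nat.le_zero] at hs
    subst hs
    exact ⟨⟨Unit, fun _ _ => (), fun _ _ _ _ => false, fun _ _ _ => (), fun _ _ _ => 2⟩, 0,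
      by rw [Nat.cast_zero]; positivity, fun _ _ _ _ _ _ i => i.elim0⟩
  · obtain ⟨alg, T, hT, halg⟩ := hC n s M R hs hM hR
    have hn1 : (1 : ℝ) ≤ n := by exact_mod_cast hn
    refine ⟨alg, T, hT.trans ?_, halg⟩
    calc C * (R * (n : ℝ) ^ e * Real.log M) ≤ max C 0 * (R * (n : ℝ) ^ e * Real.log M) := by
          gcongr
          exact le_max_left _ _
      _ ≤ _ := by gcongr

/-- For `σ = w + ε` the loss is `2 * ε / (w * σ)`, and `w * σ ≥ 4`. -/
theorem exists_gt_div_le (w : ℝ) (hw : 2 ≤ w) {ε : ℝ} (hε : 0 < ε) :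
    ∃ σ, w < σ ∧ 1 - 2 / σ ≤ 1 - 2 / w + ε := by
  refine ⟨w + ε, by linarith, ?_⟩
  have hw0 : 0 < w := by linarith
  have h1 : 2 / w - 2 / (w + ε) = 2 * ε / (w * (w + ε)) := by field_simp; ring
  have h2 : 2 * ε / (w * (w + ε)) ≤ ε := by
    rw [div_le_iff₀ (by positivity), mul_comm 2]
    refine mul_le_mul_of_nonneg_left ?_ hε.le
    nlinarith
  linarith

theorem mainTheorem4 (r : ℝ) (hr0 : 0 < r) (hr1 : r ≤ 1) :
    ∃ r' : ℝ,
      (r' = 1 - (1 - r) * mmExponent r' ∧ ∀ x : ℝ, x = 1 - (1 - r) * mmExponent x → x = r') ∧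
      (HasMMExponent r' (mmExponent r') →
        ApproxMinPlusInRounds r (1 - 2 / mmExponent r')) ∧
      (∀ ε : ℝ, 0 < ε →
        ApproxMinPlusInRounds r (1 - 2 / mmExponent r' + ε)) := by
  obtain ⟨r', hr', huniq⟩ := exists_unique_balanced hr1
  have hω := two_le_mmExponent r'
  have hr : 0 ≤ 1 - r := by linarith
  have hr'1 : r' ≤ 1 := by
    have : 0 ≤ (1 - r) * mmExponent r' := mul_nonneg hr (by linarith)
    linarith
  refine ⟨r', ⟨hr', huniq⟩, fun h => ?_, fun ε hε => ?_⟩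
  · exact approxMinPlusInRounds_of_hasMMExponent hr0 hr1 hr'1 (by linarith) h
  -- An exponent slightly above the infimum is attained, and enlarging `σ` preserves the balance
  -- inequality as `0 ≤ 1 - r`.
  · obtain ⟨σ, hσ, hle⟩ := exists_gt_div_le (mmExponent r') hω hε
    refine (approxMinPlusInRounds_of_hasMMExponent hr0 hr1 hr'1 ?_
      (hasMMExponent_of_lt hσ)).mono hle hr0
    have := mul_le_mul_of_nonneg_left hσ.le hr
    linarith
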